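/- Let $\gamma$ be Euler's constant, let $A=\lim_{n\to\infty}\frac{1^1 2^2\cdots n^n}{n^{n^2/2+n/2+1/12}e^{-n^2/4}}$ be the Glaisher–Kinkelin constant, and let $G$ be the Barnes function (which satisfies $G(s+1)=\Gamma(s)G(s)$, $G(1)=1$), i.e. $$G(1+w)=(2\pi)^{w/2}\exp\!\Big(-\frac{w+(1+\gamma)w^2}{2}\Big)\prod_{k=1}^{\infty}\Big(1+\frac wk\Big)^k\exp\!\Big(\frac{w^2}{2k}-w\Big).$$ For $\operatorname{Re}a>0$ let $\zeta(s,a)$ be the Hurwitz zeta function, i.e. the analytic continuation to $s\in\mathbb C\setminus\{1\}$ of $\sum_{n\ge0}(n+a)^{-s}$ ($\operatorname{Re}s>1$), and for $n=0,1,2,\dots$ put $$g(n,a)=\zeta'(-n,a)+\psi(n+1)\,\zeta(-n,a),$$ where $\zeta'$ is the derivative in the first variable and $\psi=\Gamma'/\Gamma$. For $0<\epsilon<2\pi$ let $L$ be the Hankel contour which runs along the lower side ($\arg z=-\pi$) of the ray $(-\infty,-\epsilon)$ from left to right, then counterclockwise along the circle $z=\epsilon e^{i\theta}$, $-\pi\le\theta\le\pi$,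 and then along the upper side ($\arg z=\pi$) of the ray from right to left, with $\operatorname{Log}z=\ln|z|+i\arg z$ on it. Let $$p(a)=-\frac12(1+\gamma)a^2+\Big(\log\sqrt{2\pi}+\gamma+\frac12\Big)a-\frac{5\gamma}{12}-\log\big(A\sqrt{2\pi}\big).$$ Then there is a holomorphic branch of $\log G$ on the half-plane $\operatorname{Re}a>0$ with $\log G(1)=0$ (necessarily unique), and for every complex $a$ with $\operatorname{Re}a>0$ and every $0<\epsilon<2\pi$ the integral below converges absolutely and $$\log G(a)=p(a)+\frac1{2\pi i}\int_L\big[(a-1)z^{-1}-z^{-2}\big]\frac{e^{az}\operatorname{Log}z}{1-e^z}\,dz ,$$ and moreover $$\log G(a)=p(a)+(a-1)\,g(0,a)-g(1,a).$$ -/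

import Mathlib

open Filter Topology MeasureTheory

noncomputable section

/-- `Z` is the Hurwitz zeta function `s ↦ ζ(s, a)`: it is holomorphic on `ℂ \ {1}` and equals
`∑ n ≥ 0, (n + a)⁻ˢ` for `Re s > 1`. -/
structure IsHurwitzZeta (a : ℂ) (Z : ℂ → ℂ) : Prop where
  differentiableOn : DifferentiableOn ℂ Z {1}ᶜ
  hasSum : ∀ s : ℂ, 1 < s.re → HasSum (fun n : ℕ => 1 / ((n : ℂ) + a) ^ s) (Z s)

open Classical in
/-- The Hurwitz zeta function `ζ(s, a)` for complex `a` with `Re a > 0`, analytically continued in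
`s` to `ℂ \ {1}`. (The continuation is unique by `IsHurwitzZeta.eqOn`; the value `0` is never
used when `Re a > 0`.) -/
def complexHurwitzZeta (a : ℂ) : ℂ → ℂ :=
  if h : ∃ Z, IsHurwitzZeta a Z then h.choose else 0

theorem IsHurwitzZeta.eqOn {a : ℂ} {Z W : ℂ → ℂ} (hZ : IsHurwitzZeta a Z)
    (hW : IsHurwitzZeta a W) : Set.EqOn Z W {1}ᶜ := by
  have ho : IsOpen ({1}ᶜ : Set ℂ) := isOpen_compl_singleton
  have hc : IsPreconnected ({1}ᶜ : Set ℂ) :=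
    (isConnected_compl_singleton_of_one_lt_rank (by simp) 1).isPreconnected
  refine (hZ.differentiableOn.analyticOnNhd ho).eqOn_of_preconnected_of_eventuallyEq
    (hW.differentiableOn.analyticOnNhd ho) hc (z₀ := 2) (by simp) ?_
  have h2 : {s : ℂ | 1 < s.re} ∈ 𝓝 (2 : ℂ) :=
    (isOpen_lt continuous_const Complex.continuous_re).mem_nhds (by simp)
  filter_upwards [h2] with s hs
  exact (hZ.hasSum s hs).unique (hW.hasSum s hs)

theorem IsHurwitzZeta.complexHurwitzZeta_eqOn {a : ℂ} {Z : ℂ → ℂ} (hZ : IsHurwitzZeta a Z) :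
    Set.EqOn (complexHurwitzZeta a) Z {1}ᶜ := by
  have h : ∃ Z, IsHurwitzZeta a Z := ⟨Z, hZ⟩
  have hs : IsHurwitzZeta a (complexHurwitzZeta a) := by
    rw [complexHurwitzZeta, dif_pos h]
    exact h.choose_spec
  exact hs.eqOn hZ

/-- `g(n, a) = ζ'(-n, a) + ψ(n + 1) ζ(-n, a)`, with `'` the derivative in the first variable. -/
def hurwitzG (n : ℕ) (a : ℂ) : ℂ :=
  deriv (complexHurwitzZeta a) (-(n : ℂ)) +
    Complex.digamma ((n : ℂ) + 1) * complexHurwitzZeta a (-(n : ℂ))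

/-- The Barnes `G`-function, by its Weierstrass product
`G(1 + w) = (2π)^(w/2) exp(-(w + w²(1 + γ))/2) ∏_{k ≥ 1} (1 + w/k)ᵏ exp(w²/(2k) - w)`,
written with `w = a - 1`; the product index `k` is shifted by one. -/
def barnesG (a : ℂ) : ℂ :=
  (2 * (Real.pi : ℂ)) ^ ((a - 1) / 2) *
    Complex.exp (-((a - 1) + (a - 1) ^ 2 * (1 + (Real.eulerMascheroniConstant : ℂ))) / 2) *
    ∏' k : ℕ, (1 + (a - 1) / ((k : ℂ) + 1)) ^ (k + 1) *
      Complex.exp ((a - 1) ^ 2 / (2 * ((k : ℂ) + 1)) - (a - 1))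

theorem barnesG_one : barnesG 1 = 1 := by
  simp [barnesG]

/-- `L` is the branch of `log G` on the right half-plane `Re a > 0` that is holomorphic there and
vanishes at `1` (the half-plane is connected, so there is at most one, and it is real on
the positive real axis). -/
structure IsLogBarnesG (L : ℂ → ℂ) : Prop where
  differentiableOn : DifferentiableOn ℂ L {a : ℂ | 0 < a.re}
  exp_eq : ∀ a : ℂ, 0 < a.re → Complex.exp (L a) = barnesG a
  map_one : L 1 = 0

/-- The Glaisher-Kinkelin constant
`A = lim (1¹ 2² ⋯ nⁿ) / (n^(n²/2 + n/2 + 1/12) exp(-n²/4))`. -/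
def glaisherKinkelin : ℝ :=
  limUnder atTop (fun n : ℕ =>
    (∏ k ∈ Finset.Icc 1 n, (k : ℝ) ^ k) /
      ((n : ℝ) ^ ((n : ℝ) ^ 2 / 2 + (n : ℝ) / 2 + 1 / 12) * Real.exp (-(n : ℝ) ^ 2 / 4)))

/-- The polynomial `p(a)`. -/
def barnesPoly (a : ℂ) : ℂ :=
  -1 / 2 * (1 + (Real.eulerMascheroniConstant : ℂ)) * a ^ 2 +
    ((Real.log √(2 * Real.pi) : ℝ) + (Real.eulerMascheroniConstant : ℂ) + 1 / 2) * a -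
    5 * (Real.eulerMascheroniConstant : ℂ) / 12 -
    (Real.log (glaisherKinkelin * √(2 * Real.pi)) : ℝ)

/-- The integral over the Hankel contour with circle radius `ε` of an integrand `F z ℓ`, where `ℓ`
stands for `Log z`. On the contour `z = r e^{iθ}` with `-π ≤ θ ≤ π` and `Log z = ln r + iθ`:
the lower side `θ = -π` of the ray `(-∞, -ε)` is traced from left to right (`z = -x`, `x` from
`∞` down to `ε`), then the circle counterclockwise, then the upper side `θ = π` from right to
left. -/
def hankelIntegral (F : ℂ → ℂ → ℂ) (ε : ℝ) : ℂ :=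
  (∫ x in Set.Ioi ε, F (-(x : ℂ)) ((Real.log x : ℂ) - Real.pi * Complex.I)) +
  (∫ θ in (-Real.pi)..Real.pi,
    F (ε * Complex.exp (θ * Complex.I)) ((Real.log ε : ℂ) + θ * Complex.I) *
      (ε * Complex.I * Complex.exp (θ * Complex.I))) -
  ∫ x in Set.Ioi ε, F (-(x : ℂ)) ((Real.log x : ℂ) + Real.pi * Complex.I)

/-- The integrals over the three parts of the Hankel contour converge absolutely. -/
def HankelIntegrable (F : ℂ → ℂ → ℂ) (ε : ℝ) : Prop :=
  IntegrableOn (fun x : ℝ => F (-(x : ℂ)) ((Real.log x : ℂ) - Real.pi * Complex.I)) (Set.Ioi ε) ∧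
  IntervalIntegrable (fun θ : ℝ =>
    F (ε * Complex.exp (θ * Complex.I)) ((Real.log ε : ℂ) + θ * Complex.I) *
      (ε * Complex.I * Complex.exp (θ * Complex.I))) volume (-Real.pi) Real.pi ∧
  IntegrableOn (fun x : ℝ => F (-(x : ℂ)) ((Real.log x : ℂ) + Real.pi * Complex.I)) (Set.Ioi ε)

/-- The integrand `[(a - 1) z⁻¹ - z⁻²] e^{az} Log z / (1 - e^z)`, with `ℓ` for `Log z`. -/
def barnesIntegrand (a z ℓ : ℂ) : ℂ :=
  ((a - 1) * z⁻¹ - (z ^ 2)⁻¹) * (Complex.exp (a * z) * ℓ / (1 - Complex.exp z))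

end

/-- The density `e^{-ax} / (1 - e^{-x})` whose Mellin transform is `Γ(s) ζ(s, a)`. -/
noncomputable def boseKernel (a : ℂ) (x : ℝ) : ℂ :=
  Complex.exp (a * (-(x : ℂ))) / (1 - Complex.exp (-(x : ℂ)))

theorem one_sub_exp_ne_zero {z : ℂ} (h0 : z ≠ 0) (h : ‖z‖ < 2 * Real.pi) :
    1 - Complex.exp z ≠ 0 := by
  intro h1
  obtain ⟨n, hn⟩ := Complex.exp_eq_one_iff.1 (sub_eq_zero.1 h1).symm
  have hz : ‖z‖ = |(n : ℝ)| * (2 * Real.pi) := by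
    rw [hn]
    simp [abs_of_pos Real.pi_pos]
  have hn0 : n ≠ 0 := by
    rintro rfl
    simp at hn
    exact h0 hn
  have h2 : (1 : ℝ) ≤ |(n : ℝ)| := by exact_mod_cast Int.one_le_abs hn0
  nlinarith [Real.pi_pos]

theorem one_sub_exp_neg_ofReal_ne_zero {x : ℝ} (hx : 0 < x) : 1 - Complex.exp (-(x : ℂ)) ≠ 0 := by
  have h : Real.exp (-x) < 1 := Real.exp_lt_one_iff.2 (by linarith)
  have : (1 : ℂ) - Complex.exp (-(x : ℂ)) = ((1 - Real.exp (-x) : ℝ) : ℂ) := by push_cast; rfl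
  rw [this]
  exact_mod_cast (sub_pos.2 h).ne'

theorem norm_boseKernel (a : ℂ) {x : ℝ} (hx : 0 < x) :
    ‖boseKernel a x‖ = Real.exp (-a.re * x) / (1 - Real.exp (-x)) := by
  have h : Real.exp (-x) < 1 := Real.exp_lt_one_iff.2 (by linarith)
  have : (1 : ℂ) - Complex.exp (-(x : ℂ)) = ((1 - Real.exp (-x) : ℝ) : ℂ) := by push_cast; rfl
  rw [boseKernel, this, norm_div, Complex.norm_exp, Complex.norm_real,
    Real.norm_of_nonneg (sub_pos.2 h).le]
  simp

theorem continuousOn_boseKernel (a : ℂ) : ContinuousOn (boseKernel a) (Set.Ioi 0) := by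
  unfold boseKernel
  exact ContinuousOn.div (by fun_prop) (by fun_prop)
    fun x hx => one_sub_exp_neg_ofReal_ne_zero hx

theorem boseKernel_isBigO_exp (a : ℂ) :
    boseKernel a =O[atTop] fun x => Real.exp (-a.re * x) := by
  refine Asymptotics.IsBigO.of_bound (1 - Real.exp (-1))⁻¹ ?_
  filter_upwards [eventually_ge_atTop 1] with x hx
  rw [norm_boseKernel a (by linarith), Real.norm_of_nonneg (Real.exp_pos _).le, div_eq_inv_mul]
  have h1 : Real.exp (-1) < 1 := Real.exp_lt_one_iff.2 (by norm_num)
  gcongr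

theorem boseKernel_isBigO_rpow {a : ℂ} (ha : 0 < a.re) (b : ℝ) :
    boseKernel a =O[atTop] fun x => x ^ (-b) :=
  (boseKernel_isBigO_exp a).trans (isLittleO_exp_neg_mul_rpow_atTop ha _).isBigO

theorem boseKernel_isBigO_zero {a : ℂ} (ha : 0 < a.re) :
    boseKernel a =O[𝓝[>] 0] fun x => x ^ (-1 : ℝ) := by
  refine Asymptotics.IsBigO.of_bound 2 ?_
  filter_upwards [Ioo_mem_nhdsGT (show (0 : ℝ) < 1 by norm_num)] with x hx
  have hx0 := hx.1
  rw [norm_boseKernel a hx0, Real.rpow_neg_one, Real.norm_of_nonneg (by positivity)]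
  have h1 : Real.exp (-a.re * x) ≤ 1 := Real.exp_le_one_iff.2 (by nlinarith)
  have h2 : Real.exp (-x) * (1 + x) ≤ 1 := by
    have := Real.add_one_le_exp x
    calc Real.exp (-x) * (1 + x) ≤ Real.exp (-x) * Real.exp x := by gcongr; linarith
      _ = 1 := by rw [← Real.exp_add]; simp
  have h3 : x / 2 ≤ 1 - Real.exp (-x) := by nlinarith [hx.2, Real.exp_pos (-x)]
  calc _ ≤ 1 / (x / 2) := by gcongr
    _ = 2 * x⁻¹ := by field_simp

theorem locallyIntegrableOn_boseKernel (a : ℂ) :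
    LocallyIntegrableOn (boseKernel a) (Set.Ioi 0) :=
  (continuousOn_boseKernel a).locallyIntegrableOn measurableSet_Ioi

/-- The Bose kernel cut off to `(ε, ∞)`: its Mellin transform is entire. -/
noncomputable def truncBoseKernel (a : ℂ) (ε : ℝ) : ℝ → ℂ :=
  (Set.Ioi ε).indicator (boseKernel a)

theorem mellin_truncBoseKernel_hasDerivAt {a : ℂ} (ha : 0 < a.re) {ε : ℝ} (hε : 0 < ε) (s : ℂ) :
    MellinConvergent (fun t => (Real.log t : ℝ) • truncBoseKernel a ε t) s ∧
      HasDerivAt (mellin (truncBoseKernel a ε))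
        (mellin (fun t => (Real.log t : ℝ) • truncBoseKernel a ε t) s) s ∧
      MellinConvergent (truncBoseKernel a ε) s := by
  have h1 : LocallyIntegrableOn (truncBoseKernel a ε) (Set.Ioi 0) := by
    intro x hx
    obtain ⟨U, hU, hU'⟩ := locallyIntegrableOn_boseKernel a x hx
    exact ⟨U, hU, hU'.indicator measurableSet_Ioi⟩
  have h2 : truncBoseKernel a ε =O[atTop] fun x => x ^ (-(s.re + 1)) := by
    refine Asymptotics.IsBigO.trans ?_ (boseKernel_isBigO_rpow ha (s.re + 1))
    refine Asymptotics.IsBigO.of_bound 1 (Eventually.of_forall fun x => ?_)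
    rw [one_mul]
    exact norm_indicator_le_norm_self _ _
  have h3 : truncBoseKernel a ε =O[𝓝[>] 0] fun x => x ^ (-(s.re - 1)) := by
    refine Asymptotics.IsBigO.of_bound 1 ?_
    filter_upwards [Ioo_mem_nhdsGT hε] with x hx
    rw [truncBoseKernel, Set.indicator_of_notMem (by simpa using hx.2.le)]
    simp
  have h := mellin_hasDerivAt_of_isBigO_rpow h1 h2 (by linarith) h3 (by linarith)
  exact ⟨h.1, h.2, mellinConvergent_of_isBigO_rpow h1 h2 (by linarith) h3 (by linarith)⟩

theorem exp_mul_log_add {x : ℝ} (hx : 0 < x) (s c : ℂ) :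
    Complex.exp ((s - 1) * ((Real.log x : ℂ) + c)) =
      Complex.exp ((s - 1) * c) * (x : ℂ) ^ (s - 1) := by
  rw [Complex.cpow_def_of_ne_zero (by exact_mod_cast hx.ne'), ← Complex.exp_add,
    ← Complex.ofReal_log hx.le]
  ring_nf

theorem integrableOn_Ioi_of_indicator {ε : ℝ} (hε : 0 < ε) {f g : ℝ → ℂ}
    (h : IntegrableOn f (Set.Ioi 0)) (hfg : Set.EqOn f g (Set.Ioi ε)) :
    IntegrableOn g (Set.Ioi ε) :=
  (h.mono_set (Set.Ioi_subset_Ioi hε.le)).congr_fun hfg measurableSet_Ioi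

/-- The integral over one side of the cut, with `Log z = log x + c` there. -/
theorem hasDerivAt_rayIntegral {a : ℂ} (ha : 0 < a.re) {ε : ℝ} (hε : 0 < ε) (c s : ℂ) :
    IntegrableOn (fun x : ℝ => Complex.exp ((s - 1) * ((Real.log x : ℂ) + c)) * boseKernel a x)
      (Set.Ioi ε) ∧
    IntegrableOn (fun x : ℝ => ((Real.log x : ℂ) + c) *
      (Complex.exp ((s - 1) * ((Real.log x : ℂ) + c)) * boseKernel a x)) (Set.Ioi ε) ∧
    HasDerivAt (fun s : ℂ => ∫ x in Set.Ioi ε,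
        Complex.exp ((s - 1) * ((Real.log x : ℂ) + c)) * boseKernel a x)
      (∫ x in Set.Ioi ε, ((Real.log x : ℂ) + c) *
        (Complex.exp ((s - 1) * ((Real.log x : ℂ) + c)) * boseKernel a x)) s := by
  obtain ⟨h1, h2, h3⟩ := mellin_truncBoseKernel_hasDerivAt ha hε s
  have hi : ∀ x ∈ Set.Ioi ε, truncBoseKernel a ε x = boseKernel a x := fun x hx =>
    Set.indicator_of_mem hx _
  have i1 : IntegrableOn (fun x : ℝ => (x : ℂ) ^ (s - 1) * boseKernel a x) (Set.Ioi ε) :=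
    integrableOn_Ioi_of_indicator hε h3 fun x hx => by simp [hi x hx]
  have i2 : IntegrableOn (fun x : ℝ => (Real.log x : ℂ) * ((x : ℂ) ^ (s - 1) * boseKernel a x))
      (Set.Ioi ε) :=
    integrableOn_Ioi_of_indicator hε h1 fun x hx => by
      simp only [hi x hx, smul_eq_mul, Complex.real_smul]
      ring
  have j1 : ∀ s : ℂ, mellin (truncBoseKernel a ε) s =
      ∫ x in Set.Ioi ε, (x : ℂ) ^ (s - 1) * boseKernel a x := by
    intro s
    have : ∀ x : ℝ, (x : ℂ) ^ (s - 1) • truncBoseKernel a ε x =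
        (Set.Ioi ε).indicator (fun x => (x : ℂ) ^ (s - 1) * boseKernel a x) x := by
      intro x
      by_cases hx : x ∈ Set.Ioi ε <;> simp [truncBoseKernel, hx, -Set.mem_Ioi]
    simp only [mellin, this]
    rw [setIntegral_indicator measurableSet_Ioi,
      Set.inter_eq_self_of_subset_right (Set.Ioi_subset_Ioi hε.le)]
  have j2 : mellin (fun t => (Real.log t : ℝ) • truncBoseKernel a ε t) s =
      ∫ x in Set.Ioi ε, (Real.log x : ℂ) * ((x : ℂ) ^ (s - 1) * boseKernel a x) := by
    have : ∀ x : ℝ, (x : ℂ) ^ (s - 1) • ((Real.log x : ℝ) • truncBoseKernel a ε x) =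
        (Set.Ioi ε).indicator
          (fun x : ℝ => (Real.log x : ℂ) * ((x : ℂ) ^ (s - 1) * boseKernel a x)) x := by
      intro x
      by_cases hx : x ∈ Set.Ioi ε <;> simp [truncBoseKernel, hx, -Set.mem_Ioi]
      ring
    simp only [mellin, this]
    rw [setIntegral_indicator measurableSet_Ioi,
      Set.inter_eq_self_of_subset_right (Set.Ioi_subset_Ioi hε.le)]
  have e1 : ∀ s : ℂ, Set.EqOn
      (fun x : ℝ => Complex.exp ((s - 1) * ((Real.log x : ℂ) + c)) * boseKernel a x)
      (fun x : ℝ => Complex.exp ((s - 1) * c) * ((x : ℂ) ^ (s - 1) * boseKernel a x))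
      (Set.Ioi ε) := fun s x hx => by
    simp only [exp_mul_log_add (hε.trans hx)]
    ring
  have e2 : Set.EqOn
      (fun x : ℝ => ((Real.log x : ℂ) + c) *
        (Complex.exp ((s - 1) * ((Real.log x : ℂ) + c)) * boseKernel a x))
      (fun x : ℝ => Complex.exp ((s - 1) * c) *
        ((Real.log x : ℂ) * ((x : ℂ) ^ (s - 1) * boseKernel a x)) +
        (c * Complex.exp ((s - 1) * c)) * ((x : ℂ) ^ (s - 1) * boseKernel a x))
      (Set.Ioi ε) := fun x hx => by
    simp only [exp_mul_log_add (hε.trans hx)]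
    ring
  refine ⟨IntegrableOn.congr_fun (i1.const_mul _) (e1 s).symm measurableSet_Ioi,
    IntegrableOn.congr_fun ((i2.const_mul _).add (i1.const_mul _)) e2.symm measurableSet_Ioi, ?_⟩
  rw [setIntegral_congr_fun measurableSet_Ioi e2,
    integral_add (i2.const_mul _) (i1.const_mul _), integral_const_mul, integral_const_mul, ← j2,
    ← j1]
  have e3 : (fun s : ℂ => ∫ x in Set.Ioi ε,
      Complex.exp ((s - 1) * ((Real.log x : ℂ) + c)) * boseKernel a x) =
      fun s => Complex.exp ((s - 1) * c) * mellin (truncBoseKernel a ε) s := by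
    funext s
    rw [setIntegral_congr_fun measurableSet_Ioi (e1 s), integral_const_mul, j1]
  rw [e3]
  have hd : HasDerivAt (fun s : ℂ => Complex.exp ((s - 1) * c))
      (Complex.exp ((s - 1) * c) * (1 * c)) s :=
    (((hasDerivAt_id s).sub_const 1).mul_const c).cexp
  exact (hd.mul h2).congr_deriv (by ring)

/-- Derivative of `s ↦ ∫ exp((s - 1) ℓ(θ)) h(θ) dθ` for continuous `ℓ` and `h`. -/
theorem hasDerivAt_integral_exp_mul {l h : ℝ → ℂ} (hl : Continuous l) (hh : Continuous h)
    (p q : ℝ) (s : ℂ) :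
    HasDerivAt (fun s : ℂ => ∫ θ in p..q, Complex.exp ((s - 1) * l θ) * h θ)
      (∫ θ in p..q, l θ * (Complex.exp ((s - 1) * l θ) * h θ)) s := by
  have hb : Continuous fun θ => Real.exp ((‖s - 1‖ + 1) * ‖l θ‖) * (‖l θ‖ * ‖h θ‖) := by
    fun_prop
  refine (intervalIntegral.hasDerivAt_integral_of_dominated_loc_of_deriv_le
    (bound := fun θ => Real.exp ((‖s - 1‖ + 1) * ‖l θ‖) * (‖l θ‖ * ‖h θ‖))
    (F' := fun s θ => l θ * (Complex.exp ((s - 1) * l θ) * h θ))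
    (Metric.ball_mem_nhds s one_pos) (Eventually.of_forall fun s => ?_) ?_ ?_ ?_
    (hb.intervalIntegrable _ _) ?_).2
  · exact Continuous.aestronglyMeasurable (by fun_prop)
  · exact Continuous.intervalIntegrable (by fun_prop) _ _
  · exact Continuous.aestronglyMeasurable (by fun_prop)
  · refine Eventually.of_forall fun θ _ t ht => ?_
    have ht' : ‖t - 1‖ ≤ ‖s - 1‖ + 1 := by
      have : ‖t - s‖ < 1 := by simpa [dist_eq_norm] using ht
      calc ‖t - 1‖ = ‖(s - 1) + (t - s)‖ := by ring_nf
        _ ≤ ‖s - 1‖ + ‖t - s‖ := norm_add_le _ _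
        _ ≤ _ := by linarith
    have h1 : ‖Complex.exp ((t - 1) * l θ)‖ ≤ Real.exp ((‖s - 1‖ + 1) * ‖l θ‖) := by
      rw [Complex.norm_exp]
      refine Real.exp_le_exp.2 ((Complex.re_le_norm _).trans ?_)
      rw [norm_mul]
      gcongr
    calc _ = ‖Complex.exp ((t - 1) * l θ)‖ * (‖l θ‖ * ‖h θ‖) := by
          rw [norm_mul, norm_mul]; ring
      _ ≤ _ := by gcongr
  · refine Eventually.of_forall fun θ _ t _ => ?_
    have hd : HasDerivAt (fun s : ℂ => Complex.exp ((s - 1) * l θ))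
        (Complex.exp ((t - 1) * l θ) * (1 * l θ)) t :=
      (((hasDerivAt_id t).sub_const 1).mul_const (l θ)).cexp
    exact (hd.mul_const (h θ)).congr_deriv (by ring)

theorem integrableOn_rpow_mul_exp_neg_mul {σ b : ℝ} (hσ : -1 < σ) (hb : 0 < b) :
    IntegrableOn (fun t : ℝ => t ^ σ * Real.exp (-(b * t))) (Set.Ioi 0) := by
  have := integrableOn_rpow_mul_exp_neg_mul_rpow hσ (p := 1) one_pos hb
  simpa [neg_mul] using this

theorem norm_cpow_mul_exp_neg_mul (s r : ℂ) {t : ℝ} (ht : 0 < t) :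
    ‖(t : ℂ) ^ (s - 1) * Complex.exp (-(r * t))‖ = t ^ (s.re - 1) * Real.exp (-(r.re * t)) := by
  rw [norm_mul, Complex.norm_cpow_eq_rpow_re_of_pos ht, Complex.norm_exp]
  simp

theorem continuousOn_cpow_mul_exp_neg_mul (s r : ℂ) :
    ContinuousOn (fun t : ℝ => (t : ℂ) ^ (s - 1) * Complex.exp (-(r * t))) (Set.Ioi 0) := by
  refine ContinuousOn.mul (fun t ht => ?_) (by fun_prop)
  exact (Complex.continuousAt_ofReal_cpow_const t _ (Or.inr (ne_of_gt ht))).continuousWithinAt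

theorem integrableOn_cpow_mul_exp_neg_mul {s r : ℂ} (hs : 0 < s.re) (hr : 0 < r.re) :
    IntegrableOn (fun t : ℝ => (t : ℂ) ^ (s - 1) * Complex.exp (-(r * t))) (Set.Ioi 0) := by
  have h := integrableOn_rpow_mul_exp_neg_mul (σ := s.re - 1) (by linarith) hr
  refine Integrable.mono' h
    ((continuousOn_cpow_mul_exp_neg_mul s r).aestronglyMeasurable measurableSet_Ioi) ?_
  filter_upwards [ae_restrict_mem measurableSet_Ioi] with t ht
  exact (norm_cpow_mul_exp_neg_mul s r ht).le

/-- Euler's integral `∫ t^{s-1} e^{-rt} dt = r^{-s} Γ(s)` for complex `r` with `Re r > 0`. -/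
theorem integral_cpow_mul_exp_neg_mul_of_re_pos {s r : ℂ} (hs : 0 < s.re) (hr : 0 < r.re) :
    ∫ t in Set.Ioi (0 : ℝ), (t : ℂ) ^ (s - 1) * Complex.exp (-(r * t)) =
      1 / r ^ s * Complex.Gamma s := by
  have ho : IsOpen {r : ℂ | 0 < r.re} := isOpen_lt continuous_const Complex.continuous_re
  have hc : Convex ℝ {r : ℂ | 0 < r.re} := convex_halfSpace_re_gt 0
  have hd1 : DifferentiableOn ℂ (fun r : ℂ =>
      ∫ t in Set.Ioi (0 : ℝ), (t : ℂ) ^ (s - 1) * Complex.exp (-(r * t))) {r : ℂ | 0 < r.re} := by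
    intro r hr
    replace hr : 0 < r.re := hr
    refine DifferentiableAt.differentiableWithinAt (HasDerivAt.differentiableAt
      (hasDerivAt_integral_of_dominated_loc_of_deriv_le
      (bound := fun t => t ^ s.re * Real.exp (-(r.re / 2 * t)))
      (F' := fun r t => -((t : ℂ) ^ (s - 1) * Complex.exp (-(r * t)) * t))
      (Metric.ball_mem_nhds r (half_pos hr)) ?_ ?_ ?_ ?_ ?_ ?_).2)
    · exact Eventually.of_forall fun q =>
        (continuousOn_cpow_mul_exp_neg_mul s q).aestronglyMeasurable measurableSet_Ioi
    · exact integrableOn_cpow_mul_exp_neg_mul hs hr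
    · exact (((continuousOn_cpow_mul_exp_neg_mul s r).mul (by fun_prop)).neg).aestronglyMeasurable
        measurableSet_Ioi
    · filter_upwards [ae_restrict_mem measurableSet_Ioi] with t ht q hq
      have ht' : 0 < t := ht
      have hq' : r.re / 2 ≤ q.re := by
        have h1 : ‖q - r‖ < r.re / 2 := by simpa [dist_eq_norm] using hq
        have h2 := (Complex.abs_re_le_norm (q - r)).trans h1.le
        rw [Complex.sub_re] at h2
        linarith [(abs_le.1 h2).1]
      rw [norm_neg, norm_mul, norm_cpow_mul_exp_neg_mul s q ht, Complex.norm_real,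
        Real.norm_of_nonneg ht'.le]
      have : t ^ s.re = t ^ (s.re - 1) * t := by
        rw [← Real.rpow_add_one ht'.ne']; simp
      rw [this]
      have h3 : Real.exp (-(q.re * t)) ≤ Real.exp (-(r.re / 2 * t)) := by
        apply Real.exp_le_exp.2
        nlinarith
      calc _ = t ^ (s.re - 1) * t * Real.exp (-(q.re * t)) := by ring
        _ ≤ _ := by gcongr
    · exact integrableOn_rpow_mul_exp_neg_mul (by linarith) (half_pos hr)
    · refine Eventually.of_forall fun t q _ => ?_
      have h1 : HasDerivAt (fun q : ℂ => Complex.exp (-(q * t)))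
          (Complex.exp (-(q * t)) * -(1 * t)) q :=
        (((hasDerivAt_id q).mul_const (t : ℂ)).neg).cexp
      exact (h1.const_mul ((t : ℂ) ^ (s - 1))).congr_deriv (by ring)
  have hd2 : DifferentiableOn ℂ (fun r : ℂ => 1 / r ^ s * Complex.Gamma s)
      {r : ℂ | 0 < r.re} := by
    intro r hr
    have hr' : r ∈ Complex.slitPlane := Or.inl hr
    have h0 : r ^ s ≠ 0 := by
      rw [Ne, Complex.cpow_eq_zero_iff]
      exact fun h => Complex.slitPlane_ne_zero hr' h.1
    have hd : DifferentiableAt ℂ (fun r : ℂ => r ^ s) r :=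
      differentiableAt_id.cpow_const hr'
    exact (((differentiableAt_const _).div hd h0).mul_const _).differentiableWithinAt
  refine (hd1.analyticOnNhd ho).eqOn_of_preconnected_of_frequently_eq (hd2.analyticOnNhd ho)
    hc.isPreconnected (z₀ := 1) (by simp) ?_ hr
  have ht : Tendsto (fun x : ℝ => (x : ℂ)) (𝓝[>] 1) (𝓝[≠] 1) := by
    refine tendsto_nhdsWithin_of_tendsto_nhds_of_eventually_within _ ?_ ?_
    · exact (Complex.continuous_ofReal.tendsto' 1 1 (by simp)).mono_left nhdsWithin_le_nhds
    · filter_upwards [self_mem_nhdsWithin] with x hx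
      have : x ≠ 1 := ne_of_gt hx
      simpa using this
  refine ht.frequently (Eventually.frequently ?_)
  filter_upwards [self_mem_nhdsWithin] with x hx
  have hx0 : 0 < x := one_pos.trans hx
  rw [Complex.integral_cpow_mul_exp_neg_mul_Ioi hs hx0]
  congr 1
  rw [one_div, one_div, Complex.inv_cpow _ _ (by
    rw [Complex.arg_ofReal_of_nonneg hx0.le]; exact Real.pi_pos.ne)]

theorem hasSum_boseKernel (a : ℂ) {x : ℝ} (hx : 0 < x) :
    HasSum (fun n : ℕ => Complex.exp (-((n + a) * x))) (boseKernel a x) := by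
  have h1 : ‖Complex.exp (-(x : ℂ))‖ < 1 := by
    rw [Complex.norm_exp]
    simpa using hx
  have h := (hasSum_geometric_of_norm_lt_one h1).mul_left (Complex.exp (a * (-(x : ℂ))))
  rw [boseKernel, div_eq_mul_inv]
  refine h.congr_fun fun n => ?_
  rw [← Complex.exp_nat_mul, ← Complex.exp_add]
  ring_nf

theorem mellinConvergent_boseKernel {a s : ℂ} (ha : 0 < a.re) (hs : 1 < s.re) :
    MellinConvergent (boseKernel a) s :=
  mellinConvergent_of_isBigO_rpow (locallyIntegrableOn_boseKernel a)
    (boseKernel_isBigO_rpow ha (s.re + 1)) (by linarith) (boseKernel_isBigO_zero ha) hs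

theorem differentiableAt_mellin_boseKernel {a s : ℂ} (ha : 0 < a.re) (hs : 1 < s.re) :
    DifferentiableAt ℂ (mellin (boseKernel a)) s :=
  mellin_differentiableAt_of_isBigO_rpow (locallyIntegrableOn_boseKernel a)
    (boseKernel_isBigO_rpow ha (s.re + 1)) (by linarith) (boseKernel_isBigO_zero ha) hs

theorem natCast_add_ne_zero {a : ℂ} (ha : 0 < a.re) (n : ℕ) : (n : ℂ) + a ≠ 0 := by
  intro h
  have := congrArg Complex.re h
  simp at this
  linarith [(Nat.cast_nonneg n : (0 : ℝ) ≤ n)]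

theorem hasSum_mellin_boseKernel {a s : ℂ} (ha : 0 < a.re) (hs : 1 < s.re) :
    HasSum (fun n : ℕ => 1 / ((n : ℂ) + a) ^ s) ((Complex.Gamma s)⁻¹ * mellin (boseKernel a) s) := by
  have hr : ∀ n : ℕ, 0 < ((n : ℂ) + a).re := fun n => by
    simp
    positivity
  have hs0 : 0 < s.re := by linarith
  have hsum : Summable fun n : ℕ => ∫ x in Set.Ioi (0 : ℝ),
      ‖(x : ℂ) ^ (s - 1) * Complex.exp (-(((n : ℂ) + a) * x))‖ := by
    have h1 : ∀ n : ℕ, ∫ x in Set.Ioi (0 : ℝ),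
        ‖(x : ℂ) ^ (s - 1) * Complex.exp (-(((n : ℂ) + a) * x))‖ =
        (1 / (n + a.re)) ^ s.re * Real.Gamma s.re := by
      intro n
      rw [setIntegral_congr_fun measurableSet_Ioi
        (fun x hx => norm_cpow_mul_exp_neg_mul s (n + a) hx),
        Real.integral_rpow_mul_exp_neg_mul_Ioi hs0 (hr n)]
      simp
    simp only [h1]
    refine Summable.mul_right _ ?_
    rw [← summable_nat_add_iff 1]
    refine Summable.of_nonneg_of_le (fun n => by positivity) (fun n => ?_)
      ((summable_nat_add_iff 1).2 (Real.summable_one_div_nat_rpow.2 hs))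
    rw [Real.div_rpow (by norm_num) (by positivity), Real.one_rpow]
    gcongr
    linarith
  have h := hasSum_integral_of_summable_integral_norm
    (fun n => integrableOn_cpow_mul_exp_neg_mul hs0 (hr n)) hsum
  have he : ∫ x in Set.Ioi (0 : ℝ), ∑' n : ℕ,
      (x : ℂ) ^ (s - 1) * Complex.exp (-(((n : ℂ) + a) * x)) = mellin (boseKernel a) s := by
    refine setIntegral_congr_fun measurableSet_Ioi fun x hx => ?_
    exact ((hasSum_boseKernel a hx).mul_left _).tsum_eq
  rw [he] at h
  have hG : Complex.Gamma s ≠ 0 := Complex.Gamma_ne_zero_of_re_pos hs0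
  refine (h.mul_left (Complex.Gamma s)⁻¹).congr_fun fun n => ?_
  rw [integral_cpow_mul_exp_neg_mul_of_re_pos hs0 (hr n)]
  field_simp

/-- The Hankel integrand `z^{s-1} e^{az} / (1 - e^z)`, with `ℓ` for `Log z`. -/
noncomputable def hankelKernel (a s z ℓ : ℂ) : ℂ :=
  Complex.exp ((s - 1) * ℓ) * (Complex.exp (a * z) / (1 - Complex.exp z))

theorem norm_ofReal_mul_exp_mul_I {ε : ℝ} (hε : 0 < ε) (θ : ℝ) :
    ‖(ε : ℂ) * Complex.exp (θ * Complex.I)‖ = ε := by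
  rw [norm_mul, Complex.norm_exp_ofReal_mul_I, mul_one, Complex.norm_real,
    Real.norm_of_nonneg hε.le]

theorem one_sub_exp_circle_ne_zero {ε : ℝ} (hε : 0 < ε) (hε' : ε < 2 * Real.pi) (θ : ℝ) :
    1 - Complex.exp (ε * Complex.exp (θ * Complex.I)) ≠ 0 := by
  have h := norm_ofReal_mul_exp_mul_I hε θ
  refine one_sub_exp_ne_zero (fun h0 => ?_) (lt_of_eq_of_lt h hε')
  rw [h0, norm_zero] at h
  exact hε.ne h

theorem continuous_circleFactor (a : ℂ) {ε : ℝ} (hε : 0 < ε) (hε' : ε < 2 * Real.pi) :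
    Continuous fun θ : ℝ => Complex.exp (a * (ε * Complex.exp (θ * Complex.I))) /
      (1 - Complex.exp (ε * Complex.exp (θ * Complex.I))) *
      (ε * Complex.I * Complex.exp (θ * Complex.I)) :=
  (Continuous.div (by fun_prop) (by fun_prop) (one_sub_exp_circle_ne_zero hε hε')).mul
    (by fun_prop)

theorem hankelKernel_integrable_hasDerivAt {a : ℂ} (ha : 0 < a.re) {ε : ℝ} (hε : 0 < ε)
    (hε' : ε < 2 * Real.pi) (s : ℂ) :
    HankelIntegrable (hankelKernel a s) ε ∧
    HankelIntegrable (fun z ℓ => ℓ * hankelKernel a s z ℓ) ε ∧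
    HasDerivAt (fun s => hankelIntegral (hankelKernel a s) ε)
      (hankelIntegral (fun z ℓ => ℓ * hankelKernel a s z ℓ) ε) s := by
  obtain ⟨l1, l2, l3⟩ := hasDerivAt_rayIntegral ha hε (-(Real.pi * Complex.I)) s
  obtain ⟨u1, u2, u3⟩ := hasDerivAt_rayIntegral ha hε (Real.pi * Complex.I) s
  have hl : Continuous fun θ : ℝ => (Real.log ε : ℂ) + θ * Complex.I := by fun_prop
  have hh := continuous_circleFactor a hε hε'
  have c3 := hasDerivAt_integral_exp_mul hl hh (-Real.pi) Real.pi s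
  simp only [← sub_eq_add_neg] at l1 l2 l3
  have e1 : ∀ (s : ℂ) (θ : ℝ), hankelKernel a s (ε * Complex.exp (θ * Complex.I))
      ((Real.log ε : ℂ) + θ * Complex.I) * (ε * Complex.I * Complex.exp (θ * Complex.I)) =
      Complex.exp ((s - 1) * ((Real.log ε : ℂ) + θ * Complex.I)) *
        (Complex.exp (a * (ε * Complex.exp (θ * Complex.I))) /
      (1 - Complex.exp (ε * Complex.exp (θ * Complex.I))) *
      (ε * Complex.I * Complex.exp (θ * Complex.I))) := fun s θ => by
    rw [hankelKernel]; ring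
  refine ⟨⟨l1, ?_, u1⟩, ⟨l2, ?_, u2⟩, ?_⟩
  · simp only [e1]
    exact Continuous.intervalIntegrable (by fun_prop) _ _
  · simp only [mul_assoc ((Real.log ε : ℂ) + _), e1]
    exact Continuous.intervalIntegrable (by fun_prop) _ _
  · simp only [hankelIntegral, mul_assoc ((Real.log ε : ℂ) + _), e1]
    exact (l3.add c3).sub u3

theorem hankelKernel_rays {a s : ℂ} {x : ℝ} (hx : 0 < x) (c : ℂ) :
    hankelKernel a s (-(x : ℂ)) ((Real.log x : ℂ) + c) =
      Complex.exp ((s - 1) * c) * ((x : ℂ) ^ (s - 1) * boseKernel a x) := by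
  rw [hankelKernel, exp_mul_log_add hx, boseKernel, mul_assoc]

/-- The pull-back of the Hankel integrand to the logarithmic coordinate. -/
noncomputable def logHankelKernel (a s ℓ : ℂ) : ℂ :=
  hankelKernel a s (Complex.exp ℓ) ℓ * Complex.exp ℓ

theorem integral_logHankelKernel_side {a s c : ℂ} (hc : Complex.exp c = -1) {δ ε : ℝ}
    (hδ : 0 < δ) (h : δ ≤ ε) :
    ∫ u in (Real.log δ)..(Real.log ε), logHankelKernel a s (u + c) =
      -∫ x in Set.Ioc δ ε, hankelKernel a s (-(x : ℂ)) ((Real.log x : ℂ) + c) := by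
  have hε := hδ.trans_le h
  have hcont : ContinuousOn (fun x : ℝ => hankelKernel a s (-(x : ℂ)) ((Real.log x : ℂ) + c))
      (Set.Ioi 0) := by
    have h1 : ContinuousOn (fun x : ℝ => Complex.exp ((s - 1) * ((Real.log x : ℂ) + c)))
        (Set.Ioi 0) := by
      have : ContinuousOn Real.log (Set.Ioi 0) :=
        Real.continuousOn_log.mono fun x hx => ne_of_gt hx
      fun_prop
    exact h1.mul (continuousOn_boseKernel a)
  have key := intervalIntegral.integral_deriv_smul_comp''' (a := Real.log δ) (b := Real.log ε)
    (f := Real.exp) (f' := Real.exp)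
    (g := fun x : ℝ => hankelKernel a s (-(x : ℂ)) ((Real.log x : ℂ) + c))
    Real.continuous_exp.continuousOn (fun x _ => (Real.hasDerivAt_exp x).hasDerivWithinAt)
    (hcont.mono (by rintro _ ⟨x, _, rfl⟩; exact Real.exp_pos x))
    ((hcont.mono (by
      rintro _ ⟨x, _, rfl⟩; exact Real.exp_pos x)).integrableOn_compact
        (isCompact_uIcc.image Real.continuous_exp))
    (ContinuousOn.integrableOn_compact isCompact_uIcc (by
      refine Real.continuous_exp.continuousOn.smul (hcont.comp Real.continuous_exp.continuousOn ?_)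
      exact fun x _ => Real.exp_pos x))
  rw [Real.exp_log hδ, Real.exp_log hε, intervalIntegral.integral_of_le h] at key
  rw [← key, ← intervalIntegral.integral_neg]
  refine intervalIntegral.integral_congr fun u _ => ?_
  have : Complex.exp ((u : ℂ) + c) = -Complex.exp u := by rw [Complex.exp_add, hc]; ring
  simp [logHankelKernel, this]
  ring

theorem hankelIntegral_hankelKernel_eq {a s : ℂ} (ha : 0 < a.re) {δ ε : ℝ} (hδ : 0 < δ)
    (h : δ ≤ ε) (hε' : ε < 2 * Real.pi) :
    hankelIntegral (hankelKernel a s) δ = hankelIntegral (hankelKernel a s) ε := by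
  have hε := hδ.trans_le h
  have hlog : Real.log δ ≤ Real.log ε := Real.log_le_log hδ h
  have hpi : Complex.exp (Real.pi * Complex.I) = -1 := Complex.exp_pi_mul_I
  have hpi' : Complex.exp (-(Real.pi * Complex.I)) = -1 := by
    rw [Complex.exp_neg, hpi]; norm_num
  have hd : DifferentiableOn ℂ (logHankelKernel a s)
      (Set.uIcc (Real.log δ) (Real.log ε) ×ℂ Set.uIcc (-Real.pi) Real.pi) := by
    intro ℓ hℓ
    have h1 : ℓ.re ≤ Real.log ε := by
      have := hℓ.1
      rw [Set.mem_preimage, Set.uIcc_of_le hlog] at this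
      exact this.2
    have h2 : 1 - Complex.exp (Complex.exp ℓ) ≠ 0 := by
      refine one_sub_exp_ne_zero (Complex.exp_ne_zero _) ?_
      rw [Complex.norm_exp]
      refine lt_of_le_of_lt ?_ hε'
      rw [← Real.exp_log hε]
      exact Real.exp_le_exp.2 h1
    have : DifferentiableAt ℂ (logHankelKernel a s) ℓ := by
      unfold logHankelKernel hankelKernel
      exact ((by fun_prop : DifferentiableAt ℂ (fun ℓ => Complex.exp ((s - 1) * ℓ)) ℓ).mul
        (DifferentiableAt.div (by fun_prop) (by fun_prop) h2)).mul (by fun_prop)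
    exact this.differentiableWithinAt
  have key := Complex.integral_boundary_rect_eq_zero_of_differentiableOn (logHankelKernel a s)
    ⟨Real.log δ, -Real.pi⟩ ⟨Real.log ε, Real.pi⟩ hd
  have s1 := integral_logHankelKernel_side (a := a) (s := s) hpi hδ h
  have s2 := integral_logHankelKernel_side (a := a) (s := s) hpi' hδ h
  have hcirc : ∀ η : ℝ, 0 < η → Complex.I • ∫ y in (-Real.pi)..Real.pi,
      logHankelKernel a s ((Real.log η : ℂ) + y * Complex.I) =
      ∫ θ in (-Real.pi)..Real.pi, hankelKernel a s (η * Complex.exp (θ * Complex.I))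
        ((Real.log η : ℂ) + θ * Complex.I) * (η * Complex.I * Complex.exp (θ * Complex.I)) := by
    intro η hη
    rw [← intervalIntegral.integral_smul]
    refine intervalIntegral.integral_congr fun θ _ => ?_
    have : Complex.exp ((Real.log η : ℂ) + θ * Complex.I) = η * Complex.exp (θ * Complex.I) := by
      rw [Complex.exp_add, ← Complex.ofReal_exp, Real.exp_log hη]
    simp only [logHankelKernel, this, smul_eq_mul]
    ring
  simp only [hcirc δ hδ, hcirc ε hε] at key
  have hneg : ∀ x : ℝ, (x : ℂ) + ((-Real.pi : ℝ) : ℂ) * Complex.I =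
      x + -(Real.pi * Complex.I) := fun x => by push_cast; ring
  simp only [hneg] at key
  rw [s1, s2] at key
  have hi := (hankelKernel_integrable_hasDerivAt ha hδ (h.trans_lt hε') s).1
  have hsplit : ∀ f : ℝ → ℂ, IntegrableOn f (Set.Ioi δ) →
      ∫ x in Set.Ioi δ, f x = (∫ x in Set.Ioc δ ε, f x) + ∫ x in Set.Ioi ε, f x := by
    intro f hf
    rw [← Set.Ioc_union_Ioi_eq_Ioi h]
    rw [← Set.Ioc_union_Ioi_eq_Ioi h] at hf
    exact setIntegral_union (Set.Ioc_disjoint_Ioi le_rfl) measurableSet_Ioi hf.left_of_union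
      hf.right_of_union
  rw [hankelIntegral, hankelIntegral, hsplit _ hi.1, hsplit _ hi.2.2]
  simp only [sub_eq_add_neg (Real.log _ : ℂ)]
  linear_combination -key

theorem norm_div_one_sub_exp_le {z : ℂ} (h0 : z ≠ 0) (h : ‖z‖ ≤ 1 / 2) :
    ‖z / (1 - Complex.exp z)‖ ≤ 2 := by
  have h1 := Complex.norm_exp_sub_one_sub_id_le (x := z) (by linarith)
  have h2 : ‖z‖ / 2 ≤ ‖1 - Complex.exp z‖ := by
    have h3 : ‖z‖ ≤ ‖Complex.exp z - 1 - z‖ + ‖1 - Complex.exp z‖ := by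
      calc ‖z‖ = ‖(Complex.exp z - 1 - z) + (1 - Complex.exp z)‖ := by
            rw [← norm_neg]; ring_nf
        _ ≤ _ := norm_add_le _ _
    nlinarith [norm_nonneg z]
  have h3 : 0 < ‖z‖ := norm_pos_iff.2 h0
  rw [norm_div, div_le_iff₀ (by linarith)]
  linarith

theorem tendsto_circleIntegral_hankelKernel {a s : ℂ} (hs : 1 < s.re) :
    Tendsto (fun δ : ℝ => ∫ θ in (-Real.pi)..Real.pi,
      hankelKernel a s (δ * Complex.exp (θ * Complex.I)) ((Real.log δ : ℂ) + θ * Complex.I) *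
        (δ * Complex.I * Complex.exp (θ * Complex.I))) (𝓝[>] 0) (𝓝 0) := by
  set C := Real.exp (|s.im| * Real.pi) * (Real.exp ‖a‖ * 2) with hC
  have hb : ∀ᶠ δ : ℝ in 𝓝[>] 0, ‖∫ θ in (-Real.pi)..Real.pi,
      hankelKernel a s (δ * Complex.exp (θ * Complex.I)) ((Real.log δ : ℂ) + θ * Complex.I) *
        (δ * Complex.I * Complex.exp (θ * Complex.I))‖ ≤
      (δ ^ (s.re - 1) * C) * |Real.pi - -Real.pi| := by
    filter_upwards [Ioo_mem_nhdsGT (show (0 : ℝ) < 1 / 2 by norm_num)] with δ hδ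
    have hδ0 := hδ.1
    refine intervalIntegral.norm_integral_le_of_norm_le_const fun θ hθ => ?_
    rw [Set.uIoc_of_le (by linarith [Real.pi_pos])] at hθ
    have hθ' : |θ| ≤ Real.pi := abs_le.2 ⟨hθ.1.le, hθ.2⟩
    have hz := norm_ofReal_mul_exp_mul_I hδ0 θ
    set z := (δ : ℂ) * Complex.exp (θ * Complex.I) with hzdef
    have hz0 : z ≠ 0 := norm_pos_iff.1 (hz ▸ hδ0)
    have e : hankelKernel a s z ((Real.log δ : ℂ) + θ * Complex.I) *
        (δ * Complex.I * Complex.exp (θ * Complex.I)) =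
        Complex.exp ((s - 1) * ((Real.log δ : ℂ) + θ * Complex.I)) *
          (Complex.exp (a * z) * (z / (1 - Complex.exp z))) * Complex.I := by
      rw [hankelKernel, hzdef]; ring
    rw [e, norm_mul, Complex.norm_I, mul_one, norm_mul, norm_mul, hC]
    have h1 : ‖Complex.exp ((s - 1) * ((Real.log δ : ℂ) + θ * Complex.I))‖ ≤
        δ ^ (s.re - 1) * Real.exp (|s.im| * Real.pi) := by
      rw [Complex.norm_exp, Real.rpow_def_of_pos hδ0, ← Real.exp_add]
      apply Real.exp_le_exp.2
      have : ((s - 1) * ((Real.log δ : ℂ) + θ * Complex.I)).re =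
          Real.log δ * (s.re - 1) + -(s.im * θ) := by
        simp [Complex.mul_re]; ring
      rw [this]
      have h2 : -(s.im * θ) ≤ |s.im| * |θ| := by
        rw [← abs_mul]; exact neg_le_abs _
      have h3 : |s.im| * |θ| ≤ |s.im| * Real.pi := by gcongr
      linarith
    have h2 : ‖Complex.exp (a * z)‖ ≤ Real.exp ‖a‖ := by
      rw [Complex.norm_exp]
      apply Real.exp_le_exp.2
      refine (Complex.re_le_norm _).trans ?_
      rw [norm_mul, hz]
      nlinarith [norm_nonneg a, hδ.2]
    have h3 := norm_div_one_sub_exp_le hz0 (hz ▸ hδ.2.le)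
    calc _ ≤ (δ ^ (s.re - 1) * Real.exp (|s.im| * Real.pi)) * (Real.exp ‖a‖ * 2) := by gcongr
      _ = _ := by ring
  refine squeeze_zero_norm' hb ?_
  have : Tendsto (fun δ : ℝ => δ ^ (s.re - 1)) (𝓝[>] 0) (𝓝 0) := by
    have h := (Real.continuousAt_rpow_const 0 (s.re - 1) (Or.inr (by linarith))).tendsto
    rw [Real.zero_rpow (by linarith)] at h
    exact h.mono_left nhdsWithin_le_nhds
  simpa using (this.mul_const C).mul_const |Real.pi - -Real.pi|

theorem hankelIntegral_hankelKernel_of_one_lt_re {a s : ℂ} (ha : 0 < a.re) (hs : 1 < s.re)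
    {ε : ℝ} (hε : 0 < ε) (hε' : ε < 2 * Real.pi) :
    hankelIntegral (hankelKernel a s) ε =
      2 * Complex.I * Complex.sin (Real.pi * s) * mellin (boseKernel a) s := by
  have hm := mellinConvergent_boseKernel ha hs
  have hray : Tendsto (fun δ : ℝ => ∫ x in Set.Ioi δ, (x : ℂ) ^ (s - 1) * boseKernel a x) (𝓝[>] 0)
      (𝓝 (mellin (boseKernel a) s)) := by
    have hcov : AECover (volume.restrict (Set.Ioi (0 : ℝ))) (𝓝[>] (0 : ℝ)) fun δ => Set.Ioi δ :=
      aecover_Ioi_of_Ioi (tendsto_id.mono_left nhdsWithin_le_nhds)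
    have h := hcov.integral_tendsto_of_countably_generated hm
    refine h.congr' ?_
    filter_upwards [self_mem_nhdsWithin] with δ hδ
    rw [Measure.restrict_restrict measurableSet_Ioi,
      Set.inter_eq_self_of_subset_left (Set.Ioi_subset_Ioi (le_of_lt hδ))]
    rfl
  have hlim := (((hray.const_mul (Complex.exp ((s - 1) * -(Real.pi * Complex.I)))).add
    (tendsto_circleIntegral_hankelKernel (a := a) hs)).sub
      (hray.const_mul (Complex.exp ((s - 1) * (Real.pi * Complex.I)))))
  have hconst : Tendsto (fun _ : ℝ => hankelIntegral (hankelKernel a s) ε) (𝓝[>] 0)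
      (𝓝 (hankelIntegral (hankelKernel a s) ε)) := tendsto_const_nhds
  have := tendsto_nhds_unique (hlim.congr' ?_) hconst
  · rw [← this, Complex.sin]
    have e1 : Complex.exp ((s - 1) * -(Real.pi * Complex.I)) =
        -Complex.exp (-(Real.pi * s) * Complex.I) := by
      rw [show (s - 1) * -(Real.pi * Complex.I) =
        -(Real.pi * s) * Complex.I + Real.pi * Complex.I by ring, Complex.exp_add,
        Complex.exp_pi_mul_I]
      ring
    have e2 : Complex.exp ((s - 1) * (Real.pi * Complex.I)) =
        -Complex.exp ((Real.pi * s) * Complex.I) := by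
      rw [show (s - 1) * (Real.pi * Complex.I) =
        (Real.pi * s) * Complex.I - Real.pi * Complex.I by ring, Complex.exp_sub,
        Complex.exp_pi_mul_I]
      ring
    rw [e1, e2]
    linear_combination (Complex.exp (-(Real.pi * s) * Complex.I) -
      Complex.exp ((Real.pi * s) * Complex.I)) * mellin (boseKernel a) s * (-Complex.I_sq)
  · filter_upwards [Ioo_mem_nhdsGT hε] with δ hδ
    rw [← hankelIntegral_hankelKernel_eq ha hδ.1 hδ.2.le hε', hankelIntegral,
      ← integral_const_mul, ← integral_const_mul]
    have hδ' : ∀ x ∈ Set.Ioi δ, 0 < x := fun x hx => hδ.1.trans hx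
    congr 1
    · congr 1
      refine setIntegral_congr_fun measurableSet_Ioi fun x hx => ?_
      simp only [sub_eq_add_neg (Real.log _ : ℂ)]
      rw [hankelKernel_rays (hδ' x hx)]
    · refine setIntegral_congr_fun measurableSet_Ioi fun x hx => ?_
      rw [hankelKernel_rays (hδ' x hx)]

open Classical in
/-- The Hurwitz zeta function through Hankel's integral. -/
theorem exists_isHurwitzZeta_hankel {a : ℂ} (ha : 0 < a.re) {ε : ℝ} (hε : 0 < ε)
    (hε' : ε < 2 * Real.pi) :
    ∃ Z, IsHurwitzZeta a Z ∧ ∀ s : ℂ, s.re < 1 → Z s = Complex.Gamma (1 - s) *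
      (1 / (2 * Real.pi * Complex.I) * hankelIntegral (hankelKernel a s) ε) := by
  set W : ℂ → ℂ := fun s => (Complex.Gamma s)⁻¹ * mellin (boseKernel a) s with hW
  set V : ℂ → ℂ := fun s => Complex.Gamma (1 - s) *
      (1 / (2 * Real.pi * Complex.I) * hankelIntegral (hankelKernel a s) ε) with hV
  have hVW : ∀ s : ℂ, 1 < s.re → s.re < 2 → V s = W s := by
    intro s h1 h2
    have hG := Complex.Gamma_mul_Gamma_one_sub s
    have hG0 : Complex.Gamma s ≠ 0 := Complex.Gamma_ne_zero_of_re_pos (by linarith)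
    have hpi : (Real.pi : ℂ) ≠ 0 := by exact_mod_cast Real.pi_ne_zero
    have hsin : Complex.sin (Real.pi * s) ≠ 0 := by
      rw [Ne, Complex.sin_eq_zero_iff]
      rintro ⟨k, hk⟩
      have hk' : s = k := mul_left_cancel₀ hpi (by rw [hk]; ring)
      rw [hk'] at h1 h2
      simp only [Complex.intCast_re] at h1 h2
      have h3 : (1 : ℤ) < k := by exact_mod_cast h1
      have h4 : k < (2 : ℤ) := by exact_mod_cast h2
      omega
    have hG' : Complex.Gamma (1 - s) = (Complex.Gamma s)⁻¹ * (Real.pi / Complex.sin (Real.pi * s)) :=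
      by rw [← hG]; field_simp
    simp only [hV, hW]
    rw [hankelIntegral_hankelKernel_of_one_lt_re ha h1 hε hε', hG']
    have := Complex.I_ne_zero
    field_simp
  refine ⟨fun s => if 1 < s.re then W s else V s, ⟨fun s hs => ?_, fun s hs => ?_⟩, fun s hs => ?_⟩
  · refine DifferentiableAt.differentiableWithinAt ?_
    by_cases h : 1 < s.re
    · have hd : DifferentiableAt ℂ W s :=
        (Complex.differentiable_one_div_Gamma s).mul (differentiableAt_mellin_boseKernel ha h)
      refine hd.congr_of_eventuallyEq ?_
      filter_upwards [(isOpen_lt continuous_const Complex.continuous_re).mem_nhds h] with t ht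
      exact if_pos ht
    · have hd : DifferentiableAt ℂ V s := by
        have h1 : DifferentiableAt ℂ (fun s : ℂ => Complex.Gamma (1 - s)) s := by
          refine DifferentiableAt.comp s (Complex.differentiableAt_Gamma _ fun m hm => ?_)
            (by fun_prop)
          have hm' : s = 1 + m := by linear_combination -hm
          have : m ≠ 0 := by
            rintro rfl
            exact hs (by simpa using hm')
          rw [hm'] at h
          have h2 : (0 : ℝ) < m := by exact_mod_cast Nat.pos_of_ne_zero this
          simp at h
          exact this h
        exact h1.mul ((hankelKernel_integrable_hasDerivAt ha hε hε' s).2.2.differentiableAt.const_mul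
          _)
      refine hd.congr_of_eventuallyEq ?_
      have h2 : s.re < 2 := by linarith
      filter_upwards [(isOpen_lt Complex.continuous_re continuous_const).mem_nhds h2] with t ht
      by_cases h3 : 1 < t.re
      · simp only [h3, if_true]
        exact (hVW t h3 ht).symm
      · simp only [h3, if_false]
  · simp only [hs, if_true]
    exact hasSum_mellin_boseKernel ha hs
  · simp only [not_lt.2 hs.le, if_false, hV]

theorem isHurwitzZeta_complexHurwitzZeta {a : ℂ} (ha : 0 < a.re) :
    IsHurwitzZeta a (complexHurwitzZeta a) := by
  have h : ∃ Z, IsHurwitzZeta a Z :=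
    let ⟨Z, hZ, _⟩ := exists_isHurwitzZeta_hankel ha one_pos (by linarith [Real.pi_gt_three])
    ⟨Z, hZ⟩
  rw [complexHurwitzZeta, dif_pos h]
  exact h.choose_spec

theorem complexHurwitzZeta_eq_hankel {a : ℂ} (ha : 0 < a.re) {ε : ℝ} (hε : 0 < ε)
    (hε' : ε < 2 * Real.pi) {s : ℂ} (hs : s.re < 1) :
    complexHurwitzZeta a s = Complex.Gamma (1 - s) *
      (1 / (2 * Real.pi * Complex.I) * hankelIntegral (hankelKernel a s) ε) := by
  obtain ⟨Z, hZ, h⟩ := exists_isHurwitzZeta_hankel ha hε hε'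
  rw [hZ.complexHurwitzZeta_eqOn, h s hs]
  rintro rfl
  simp at hs

/-- `g(n, a) = n! / (2πi) ∫ z^{-n-1} e^{az} Log z / (1 - e^z) dz`. -/
theorem hurwitzG_eq_hankel {a : ℂ} (ha : 0 < a.re) {ε : ℝ} (hε : 0 < ε)
    (hε' : ε < 2 * Real.pi) (n : ℕ) :
    hurwitzG n a = n.factorial * (1 / (2 * Real.pi * Complex.I) *
      hankelIntegral (fun z ℓ => ℓ * hankelKernel a (-(n : ℂ)) z ℓ) ε) := by
  have hn : (-(n : ℂ)).re < 1 := by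
    simp
    linarith [(Nat.cast_nonneg n : (0 : ℝ) ≤ n)]
  have hd := (hankelKernel_integrable_hasDerivAt ha hε hε' (-(n : ℂ))).2.2
  have hG : HasDerivAt (fun s : ℂ => Complex.Gamma (1 - s))
      (deriv Complex.Gamma (1 - -(n : ℂ)) * (0 - 1)) (-(n : ℂ)) := by
    have h1 : HasDerivAt Complex.Gamma (deriv Complex.Gamma (1 - -(n : ℂ))) (1 - -(n : ℂ)) := by
      refine (Complex.differentiableAt_Gamma _ fun m hm => ?_).hasDerivAt
      have := congrArg Complex.re hm
      simp at this
      linarith [(Nat.cast_nonneg n : (0 : ℝ) ≤ n), (Nat.cast_nonneg m : (0 : ℝ) ≤ m)]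
    exact h1.comp _ ((hasDerivAt_const _ _).sub (hasDerivAt_id _))
  have hz : HasDerivAt (complexHurwitzZeta a) _ (-(n : ℂ)) :=
    (hG.mul (hd.const_mul (1 / (2 * Real.pi * Complex.I)))).congr_of_eventuallyEq (by
      filter_upwards [(isOpen_lt Complex.continuous_re continuous_const).mem_nhds hn] with t ht
      exact complexHurwitzZeta_eq_hankel ha hε hε' ht)
  have e : (1 : ℂ) - -(n : ℂ) = n + 1 := by ring
  rw [hurwitzG, hz.deriv, complexHurwitzZeta_eq_hankel ha hε hε' hn, Complex.digamma_def,
    logDeriv_apply, e, Complex.Gamma_nat_eq_factorial]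
  have : (n.factorial : ℂ) ≠ 0 := by exact_mod_cast n.factorial_ne_zero
  field_simp
  ring

/-- The Euler-Maclaurin approximation to `∑ n ≥ 0, (n + x)⁻ˢ`, up to the first Bernoulli term. -/
noncomputable def eulerMaclaurinTail (x s : ℂ) : ℂ :=
  x ^ (1 - s) / (s - 1) + x ^ (-s) / 2 + s * x ^ (-s - 1) / 12

/-- The Euler-Maclaurin approximation to `ζ(s, a)` after `N` terms. -/
noncomputable def eulerMaclaurinSum (a : ℂ) (N : ℕ) (s : ℂ) : ℂ :=
  ∑ n ∈ Finset.range N, ((n : ℂ) + a) ^ (-s) + eulerMaclaurinTail (N + a) s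

theorem norm_cpow_le_rpow_re {y c : ℂ} (hy : 0 < y.re) (hc : c.re ≤ 0) :
    ‖y ^ c‖ ≤ Real.exp (Real.pi * |c.im|) * y.re ^ c.re := by
  refine (Complex.norm_cpow_le y c).trans ?_
  rw [div_eq_mul_inv, ← Real.exp_neg, mul_comm]
  have h1 : -(y.arg * c.im) ≤ Real.pi * |c.im| := by
    calc -(y.arg * c.im) ≤ |y.arg * c.im| := neg_le_abs _
      _ = |y.arg| * |c.im| := abs_mul _ _
      _ ≤ _ := by gcongr; exact Complex.abs_arg_le_pi y
  have h2 : ‖y‖ ^ c.re ≤ y.re ^ c.re :=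
    Real.rpow_le_rpow_of_nonpos hy (Complex.re_le_norm y) hc
  gcongr

theorem hasDerivAt_ofReal_add_cpow {x : ℂ} (hx : 0 < x.re) (c : ℂ) {t : ℝ} (ht : 0 ≤ t) :
    HasDerivAt (fun t : ℝ => (x + t) ^ c) (c * (x + t) ^ (c - 1)) t := by
  have hs : x + t ∈ Complex.slitPlane := Or.inl (by simp; linarith)
  have h1 : HasDerivAt (fun z : ℂ => (x + z) ^ c) (c * (x + t) ^ (c - 1) * 1) (t : ℂ) :=
    ((hasDerivAt_id (t : ℂ)).const_add x).cpow_const hs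
  simpa using h1.comp_ofReal

theorem norm_eulerMaclaurin_error_le {x s : ℂ} (hx : 0 < x.re) (hs : -3 ≤ s.re) (hs1 : s ≠ 1) :
    ‖x ^ (-s) - eulerMaclaurinTail x s + eulerMaclaurinTail (x + 1) s‖ ≤
      ‖s * (s + 1) * (s + 2)‖ * (Real.exp (Real.pi * |s.im|) * x.re ^ (-s.re - 3)) := by
  set G : ℝ → ℂ := fun t =>
    ((t : ℂ) ^ 3 / 6 - (t : ℂ) ^ 2 / 4 + (t : ℂ) / 12) * (s * (s + 1) * (x + t) ^ (-s - 2)) -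
    ((t : ℂ) ^ 2 / 2 - (t : ℂ) / 2 + 1 / 12) * (-s * (x + t) ^ (-s - 1)) +
    ((t : ℂ) - 1 / 2) * (x + t) ^ (-s) - (x + t) ^ (1 - s) / (1 - s) with hG
  set G' : ℝ → ℂ := fun t => ((t : ℂ) ^ 3 / 6 - (t : ℂ) ^ 2 / 4 + (t : ℂ) / 12) *
    (-(s * (s + 1) * (s + 2)) * (x + t) ^ (-s - 3)) with hG'
  have hs1' : 1 - s ≠ 0 := sub_ne_zero.2 hs1.symm
  have hs1'' : s - 1 ≠ 0 := sub_ne_zero.2 hs1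
  have hd : ∀ t ∈ Set.Icc (0 : ℝ) 1, HasDerivWithinAt G (G' t) (Set.Icc 0 1) t := by
    intro t ht
    have ho : HasDerivAt (fun t : ℝ => (t : ℂ)) 1 t := Complex.ofRealCLM.hasDerivAt
    have p3 := (((ho.pow 3).div_const 6).sub ((ho.pow 2).div_const 4)).add (ho.div_const 12)
    have p2 := (((ho.pow 2).div_const 2).sub (ho.div_const 2)).add_const (1 / 12 : ℂ)
    have p1 := ho.sub_const (1 / 2 : ℂ)
    have q3 := (hasDerivAt_ofReal_add_cpow hx (-s - 2) ht.1).const_mul (s * (s + 1))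
    have q2 := (hasDerivAt_ofReal_add_cpow hx (-s - 1) ht.1).const_mul (-s)
    have q1 := hasDerivAt_ofReal_add_cpow hx (-s) ht.1
    have q0 := (hasDerivAt_ofReal_add_cpow hx (1 - s) ht.1).div_const (1 - s)
    refine HasDerivAt.hasDerivWithinAt ((((p3.mul q3).sub (p2.mul q2)).add (p1.mul q1)).sub
      q0 |>.congr_deriv ?_)
    have e3 : -s - 2 - 1 = -s - 3 := by ring
    have e2 : -s - 1 - 1 = -s - 2 := by ring
    have e0 : 1 - s - 1 = -s := by ring
    simp only [hG', e3, e2, e0, Pi.pow_apply, Pi.add_apply, Pi.sub_apply]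
    field_simp
    push_cast
    ring
  have hb : ∀ t ∈ Set.Ico (0 : ℝ) 1, ‖G' t‖ ≤
      ‖s * (s + 1) * (s + 2)‖ * (Real.exp (Real.pi * |s.im|) * x.re ^ (-s.re - 3)) := by
    intro t ht
    have ht0 := ht.1
    have ht1 := ht.2
    have h1 : ‖(t : ℂ) ^ 3 / 6 - (t : ℂ) ^ 2 / 4 + (t : ℂ) / 12‖ ≤ 1 := by
      have : (t : ℂ) ^ 3 / 6 - (t : ℂ) ^ 2 / 4 + (t : ℂ) / 12 =
        ((t ^ 3 / 6 - t ^ 2 / 4 + t / 12 : ℝ) : ℂ) := by push_cast; ring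
      rw [this, Complex.norm_real, Real.norm_eq_abs, abs_le]
      have a2 : t ^ 2 ≤ 1 := by nlinarith
      have a3 : t ^ 3 ≤ 1 := by nlinarith
      have b2 : 0 ≤ t ^ 2 := by positivity
      have b3 : 0 ≤ t ^ 3 := by positivity
      constructor <;> linarith
    have hre : (x + t).re = x.re + t := by simp
    have h2 : ‖(x + t) ^ (-s - 3)‖ ≤ Real.exp (Real.pi * |s.im|) * x.re ^ (-s.re - 3) := by
      have h := norm_cpow_le_rpow_re (y := x + t) (c := -s - 3) (by rw [hre]; linarith)
        (by simp; linarith)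
      have him : |(-s - 3).im| = |s.im| := by simp
      have hcre : (-s - 3).re = -s.re - 3 := by simp
      rw [him, hre, hcre] at h
      refine h.trans ?_
      have := Real.rpow_le_rpow_of_nonpos hx (by linarith : x.re ≤ x.re + t)
        (by linarith : -s.re - 3 ≤ 0)
      gcongr
    calc ‖G' t‖ = ‖(t : ℂ) ^ 3 / 6 - (t : ℂ) ^ 2 / 4 + (t : ℂ) / 12‖ *
          (‖s * (s + 1) * (s + 2)‖ * ‖(x + t) ^ (-s - 3)‖) := by
          rw [hG']; simp only [norm_mul, norm_neg]
      _ ≤ 1 * (‖s * (s + 1) * (s + 2)‖ * (Real.exp (Real.pi * |s.im|) * x.re ^ (-s.re - 3))) := by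
          gcongr
      _ = _ := one_mul _
  have h := norm_image_sub_le_of_norm_deriv_le_segment_01' hd hb
  have e : ∀ y : ℂ, y / (s - 1) = -(y / (1 - s)) := fun y => by
    rw [← neg_sub 1 s, div_neg]
  have e' : x ^ (-s) - eulerMaclaurinTail x s + eulerMaclaurinTail (x + 1) s = G 1 - G 0 := by
    simp only [hG, eulerMaclaurinTail, e, Complex.ofReal_one, Complex.ofReal_zero, add_zero]
    ring
  rwa [e']

theorem eulerMaclaurinSum_succ_sub (a s : ℂ) (N : ℕ) :
    eulerMaclaurinSum a (N + 1) s - eulerMaclaurinSum a N s =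
      ((N : ℂ) + a) ^ (-s) - eulerMaclaurinTail (N + a) s + eulerMaclaurinTail (N + a + 1) s := by
  rw [eulerMaclaurinSum, eulerMaclaurinSum, Finset.sum_range_succ]
  push_cast
  rw [show (N : ℂ) + 1 + a = N + a + 1 by ring]
  ring

/-- A bounded convex open set that contains `-1`, `0` and `2 + 2i`, and avoids the pole `1`. -/
def emRegion : Set ℂ := {s | -3 / 2 < s.re} ∩ {s | s.re - s.im < 1} ∩ Metric.ball 0 10

theorem isOpen_emRegion : IsOpen emRegion :=
  ((isOpen_lt continuous_const Complex.continuous_re).inter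
    (isOpen_lt (Complex.continuous_re.sub Complex.continuous_im) continuous_const)).inter
    Metric.isOpen_ball

theorem convex_emRegion : Convex ℝ emRegion :=
  ((convex_halfSpace_re_gt _).inter
    (convex_halfSpace_lt (Complex.reLm - Complex.imLm).isLinear 1)).inter (convex_ball _ _)

theorem emRegion_subset : emRegion ⊆ {1}ᶜ := by
  rintro s hs rfl
  have := hs.1.2
  simp at this

theorem hasDerivAt_const_cpow_sub {x : ℂ} (hx : x ≠ 0) (c s : ℂ) :
    HasDerivAt (fun s : ℂ => x ^ (c - s)) (-(Complex.log x * x ^ (c - s))) s := by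
  exact (((hasDerivAt_id s).const_sub c).const_cpow (Or.inl hx)).congr_deriv (by simp; ring)

theorem hasDerivAt_eulerMaclaurinTail {x s : ℂ} (hx : x ≠ 0) (hs : s ≠ 1) :
    HasDerivAt (eulerMaclaurinTail x)
      (-(Complex.log x * x ^ (1 - s)) / (s - 1) - x ^ (1 - s) / (s - 1) ^ 2 -
        Complex.log x * x ^ (-s) / 2 + x ^ (-s - 1) / 12 -
        s * (Complex.log x * x ^ (-s - 1)) / 12) s := by
  have hs' : s - 1 ≠ 0 := sub_ne_zero.2 hs
  have h1 := (hasDerivAt_const_cpow_sub hx 1 s).div ((hasDerivAt_id s).sub_const 1) hs'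
  have h2 := (hasDerivAt_const_cpow_sub hx 0 s).div_const 2
  have h3 := ((hasDerivAt_id s).mul (hasDerivAt_const_cpow_sub hx (-1) s)).div_const 12
  have e : eulerMaclaurinTail x = fun s =>
      x ^ (1 - s) / (s - 1) + x ^ (0 - s) / 2 + s * x ^ (-1 - s) / 12 := by
    funext s
    rw [eulerMaclaurinTail, zero_sub, show -s - 1 = -1 - s by ring]
  rw [e]
  refine ((h1.add h2).add h3).congr_deriv ?_
  simp only [id, zero_sub, show -1 - s = -s - 1 by ring]
  field_simp
  ring

theorem hasDerivAt_eulerMaclaurinSum {a s : ℂ} (ha : 0 < a.re) (hs : s ≠ 1) (N : ℕ) :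
    HasDerivAt (eulerMaclaurinSum a N)
      (∑ n ∈ Finset.range N, -(Complex.log (n + a) * ((n : ℂ) + a) ^ (-s)) +
      (-(Complex.log (N + a) * ((N : ℂ) + a) ^ (1 - s)) / (s - 1) -
        ((N : ℂ) + a) ^ (1 - s) / (s - 1) ^ 2 -
        Complex.log (N + a) * ((N : ℂ) + a) ^ (-s) / 2 + ((N : ℂ) + a) ^ (-s - 1) / 12 -
        s * (Complex.log (N + a) * ((N : ℂ) + a) ^ (-s - 1)) / 12)) s := by
  refine HasDerivAt.add (HasDerivAt.fun_sum fun n _ => ?_)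
    (hasDerivAt_eulerMaclaurinTail (natCast_add_ne_zero ha N) hs)
  simpa using hasDerivAt_const_cpow_sub (natCast_add_ne_zero ha n) 0 s

theorem tendsto_natCast_add_cpow {a c : ℂ} (ha : 0 < a.re) (hc : c.re < 0) :
    Tendsto (fun N : ℕ => ((N : ℂ) + a) ^ c) atTop (𝓝 0) := by
  have h1 : Tendsto (fun N : ℕ => Real.exp (Real.pi * |c.im|) * ((N : ℝ) + a.re) ^ c.re) atTop
      (𝓝 0) := by
    have h2 : Tendsto (fun N : ℕ => (N : ℝ) + a.re) atTop atTop :=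
      tendsto_atTop_add_const_right _ _ tendsto_natCast_atTop_atTop
    have h3 := (tendsto_rpow_neg_atTop (y := -c.re) (by linarith)).comp h2
    simp only [neg_neg] at h3
    simpa using h3.const_mul (Real.exp (Real.pi * |c.im|))
  refine squeeze_zero_norm (fun N => ?_) h1
  have h := norm_cpow_le_rpow_re (y := (N : ℂ) + a) (c := c) (by simp; positivity) hc.le
  simpa using h

theorem tendsto_eulerMaclaurinSum_of_one_lt_re {a s : ℂ} (ha : 0 < a.re) (hs : 1 < s.re) :
    Tendsto (fun N => eulerMaclaurinSum a N s) atTop (𝓝 (complexHurwitzZeta a s)) := by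
  have h1 := ((isHurwitzZeta_complexHurwitzZeta ha).hasSum s hs).tendsto_sum_nat
  have h2 := (tendsto_natCast_add_cpow (c := 1 - s) ha (by simpa using hs)).div_const (s - 1)
  have h3 := (tendsto_natCast_add_cpow (c := -s) ha (by simp; linarith)).div_const 2
  have h4 := ((tendsto_natCast_add_cpow (c := -s - 1) ha (by simp; linarith)).const_mul
    s).div_const 12
  have h := h1.add ((h2.add h3).add h4)
  simp only [zero_div, mul_zero, add_zero] at h
  refine h.congr fun N => ?_
  simp only [eulerMaclaurinSum, eulerMaclaurinTail, one_div, Complex.cpow_neg]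

theorem tendstoUniformlyOn_eulerMaclaurinSum {a : ℂ} (ha : 0 < a.re) :
    ∃ E : ℂ → ℂ, TendstoUniformlyOn (fun N => eulerMaclaurinSum a (N + 1)) E atTop emRegion := by
  set R : ℕ → ℂ → ℂ := fun n s =>
    eulerMaclaurinSum a (n + 2) s - eulerMaclaurinSum a (n + 1) s with hR
  set C : ℝ := 10 * 11 * 12 * Real.exp (Real.pi * 10) with hC
  have hsum : Summable fun n : ℕ => C * (1 / ((n + 1 : ℕ) : ℝ) ^ (3 / 2 : ℝ)) :=
    ((summable_nat_add_iff 1).2 (Real.summable_one_div_nat_rpow.2 (by norm_num))).mul_left C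
  have hb : ∀ n : ℕ, ∀ s ∈ emRegion, ‖R n s‖ ≤ C * (1 / ((n + 1 : ℕ) : ℝ) ^ (3 / 2 : ℝ)) := by
    intro n s hs
    have hsre : -3 / 2 < s.re := hs.1.1
    have hsn : ‖s‖ < 10 := by simpa using hs.2
    have hx : (((n + 1 : ℕ) : ℂ) + a).re = ((n + 1 : ℕ) : ℝ) + a.re := by simp
    have hx1 : (1 : ℝ) ≤ ((n + 1 : ℕ) : ℝ) := by exact_mod_cast Nat.le_add_left 1 n
    simp only [hR]
    rw [eulerMaclaurinSum_succ_sub a s (n + 1)]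
    refine (norm_eulerMaclaurin_error_le (by rw [hx]; linarith) (by linarith)
      (emRegion_subset hs)).trans ?_
    rw [hx, hC, mul_assoc (10 * 11 * 12 : ℝ)]
    have h1 : ‖s * (s + 1) * (s + 2)‖ ≤ 10 * 11 * 12 := by
      rw [norm_mul, norm_mul]
      have h2 : ‖s + 1‖ ≤ 11 := (norm_add_le _ _).trans (by rw [norm_one]; linarith)
      have h3 : ‖s + 2‖ ≤ 12 := (norm_add_le _ _).trans (by
        rw [show ‖(2 : ℂ)‖ = 2 by simp]; linarith)
      gcongr
    have h2 : |s.im| ≤ 10 := (Complex.abs_im_le_norm s).trans hsn.le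
    have h3 : (((n + 1 : ℕ) : ℝ) + a.re) ^ (-s.re - 3) ≤ 1 / ((n + 1 : ℕ) : ℝ) ^ (3 / 2 : ℝ) := by
      rw [one_div, ← Real.rpow_neg (by positivity)]
      calc _ ≤ ((n + 1 : ℕ) : ℝ) ^ (-s.re - 3) :=
            Real.rpow_le_rpow_of_nonpos (by linarith) (by linarith) (by linarith)
        _ ≤ _ := Real.rpow_le_rpow_of_exponent_le hx1 (by linarith)
    have h4 : (0 : ℝ) ≤ (((n + 1 : ℕ) : ℝ) + a.re) ^ (-s.re - 3) :=
      Real.rpow_nonneg (by linarith) _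
    gcongr
  have h := tendstoUniformlyOn_tsum_nat hsum hb
  refine ⟨fun s => eulerMaclaurinSum a 1 s + ∑' n, R n s, ?_⟩
  rw [Metric.tendstoUniformlyOn_iff] at h ⊢
  intro η hη
  filter_upwards [h η hη] with N hN s hs
  have e : eulerMaclaurinSum a (N + 1) s =
      eulerMaclaurinSum a 1 s + ∑ n ∈ Finset.range N, R n s := by
    simp only [hR]
    rw [Finset.sum_range_sub (fun n => eulerMaclaurinSum a (n + 1) s)]
    ring
  rw [e, dist_add_left]
  exact hN s hs

theorem tendsto_eulerMaclaurinSum {a : ℂ} (ha : 0 < a.re) {s : ℂ} (hs : s ∈ emRegion) :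
    Tendsto (fun N => eulerMaclaurinSum a (N + 1) s) atTop (𝓝 (complexHurwitzZeta a s)) ∧
    Tendsto (fun N => deriv (eulerMaclaurinSum a (N + 1)) s) atTop
      (𝓝 (deriv (complexHurwitzZeta a) s)) := by
  obtain ⟨E, hE⟩ := tendstoUniformlyOn_eulerMaclaurinSum ha
  have hE' := hE.tendstoLocallyUniformlyOn
  have hd : ∀ᶠ N : ℕ in atTop, DifferentiableOn ℂ (eulerMaclaurinSum a (N + 1)) emRegion :=
    Eventually.of_forall fun N t ht => (hasDerivAt_eulerMaclaurinSum ha (emRegion_subset ht)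
      (N + 1)).differentiableAt.differentiableWithinAt
  have hEd := hE'.differentiableOn hd isOpen_emRegion
  have h2 : (2 + 2 * Complex.I) ∈ emRegion := by
    refine ⟨⟨?_, ?_⟩, ?_⟩
    · simp; norm_num
    · simp
    · rw [mem_ball_zero_iff]
      refine (norm_add_le _ _).trans_lt ?_
      simp
      norm_num
  have heq : Set.EqOn E (complexHurwitzZeta a) emRegion := by
    refine (hEd.analyticOnNhd isOpen_emRegion).eqOn_of_preconnected_of_eventuallyEq
      (((isHurwitzZeta_complexHurwitzZeta ha).differentiableOn.mono
        emRegion_subset).analyticOnNhd isOpen_emRegion) convex_emRegion.isPreconnected h2 ?_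
    have h3 : {s : ℂ | 1 < s.re} ∈ 𝓝 (2 + 2 * Complex.I) :=
      (isOpen_lt continuous_const Complex.continuous_re).mem_nhds (by simp)
    filter_upwards [h3, isOpen_emRegion.mem_nhds h2] with t ht ht'
    exact tendsto_nhds_unique (hE.tendsto_at ht')
      ((tendsto_eulerMaclaurinSum_of_one_lt_re ha ht).comp (tendsto_add_atTop_nat 1))
  refine ⟨heq hs ▸ hE.tendsto_at hs, ?_⟩
  have h := (hE'.deriv hd isOpen_emRegion).tendsto_at hs
  rw [(heq.eventuallyEq_of_mem (isOpen_emRegion.mem_nhds hs)).deriv_eq] at h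
  exact h

theorem zero_mem_emRegion : (0 : ℂ) ∈ emRegion := by
  refine ⟨⟨?_, ?_⟩, ?_⟩ <;> simp
  norm_num

theorem neg_one_mem_emRegion : (-1 : ℂ) ∈ emRegion := by
  refine ⟨⟨?_, ?_⟩, ?_⟩ <;> norm_num

theorem eulerMaclaurinSum_zero (a : ℂ) (N : ℕ) :
    eulerMaclaurinSum a N 0 = 1 / 2 - a := by
  simp [eulerMaclaurinSum, eulerMaclaurinTail]
  ring

theorem eulerMaclaurinSum_neg_one (a : ℂ) (N : ℕ) :
    eulerMaclaurinSum a N (-1) = -(a ^ 2 - a + 1 / 6) / 2 := by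
  have h : eulerMaclaurinSum a N (-1) = ∑ n ∈ Finset.range N, ((n : ℂ) + a) -
      ((N : ℂ) + a) ^ 2 / 2 + (N + a) / 2 - 1 / 12 := by
    rw [eulerMaclaurinSum, eulerMaclaurinTail, show (1 : ℂ) - -1 = (2 : ℕ) by norm_num,
      Complex.cpow_natCast]
    norm_num
    ring
  rw [h]
  clear h
  induction N with
  | zero => simp; ring
  | succ N ih =>
    rw [Finset.sum_range_succ, ← ih]
    push_cast
    ring

theorem complexHurwitzZeta_zero {a : ℂ} (ha : 0 < a.re) : complexHurwitzZeta a 0 = 1 / 2 - a := by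
  have h := (tendsto_eulerMaclaurinSum ha zero_mem_emRegion).1
  simp only [eulerMaclaurinSum_zero a] at h
  exact tendsto_nhds_unique h tendsto_const_nhds

theorem complexHurwitzZeta_neg_one {a : ℂ} (ha : 0 < a.re) :
    complexHurwitzZeta a (-1) = -(a ^ 2 - a + 1 / 6) / 2 := by
  have h := (tendsto_eulerMaclaurinSum ha neg_one_mem_emRegion).1
  simp only [eulerMaclaurinSum_neg_one a] at h
  exact tendsto_nhds_unique h tendsto_const_nhds

theorem deriv_eulerMaclaurinSum_zero {a : ℂ} (ha : 0 < a.re) (N : ℕ) :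
    deriv (eulerMaclaurinSum a N) 0 = -∑ n ∈ Finset.range N, Complex.log (n + a) +
      ((N + a) * Complex.log (N + a) - (N + a) - Complex.log (N + a) / 2 +
        ((N : ℂ) + a)⁻¹ / 12) := by
  rw [(hasDerivAt_eulerMaclaurinSum ha (by norm_num) N).deriv]
  simp [Complex.cpow_neg_one]
  ring

theorem deriv_eulerMaclaurinSum_neg_one {a : ℂ} (ha : 0 < a.re) (N : ℕ) :
    deriv (eulerMaclaurinSum a N) (-1) =
      -∑ n ∈ Finset.range N, ((n : ℂ) + a) * Complex.log (n + a) +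
      ((N + a) ^ 2 * Complex.log (N + a) / 2 - (N + a) ^ 2 / 4 -
        (N + a) * Complex.log (N + a) / 2 + 1 / 12 + Complex.log (N + a) / 12) := by
  rw [(hasDerivAt_eulerMaclaurinSum ha (by norm_num) N).deriv,
    show (1 : ℂ) - -1 = (2 : ℕ) by norm_num, Complex.cpow_natCast]
  simp [mul_comm]
  norm_num
  ring

/-- The logarithm of the `k`-th factor of the Weierstrass product of `G(1 + w)`. -/
noncomputable def logBarnesFactor (k : ℕ) (w : ℂ) : ℂ :=
  ((k : ℂ) + 1) * Complex.log (1 + w / ((k : ℂ) + 1)) + (w ^ 2 / (2 * ((k : ℂ) + 1)) - w)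

theorem norm_log_one_add_sub_le {u : ℂ} (hu : ‖u‖ ≤ 1 / 2) :
    ‖Complex.log (1 + u) - (u - u ^ 2 / 2)‖ ≤ ‖u‖ ^ 3 := by
  have h := Complex.norm_log_sub_logTaylor_le 2 (z := u) (by linarith)
  have e : Complex.logTaylor (2 + 1) u = u - u ^ 2 / 2 := by
    simp [Complex.logTaylor_succ, Complex.logTaylor_zero]
    ring
  rw [e] at h
  refine h.trans ?_
  have h1 : (1 - ‖u‖)⁻¹ ≤ 2 := by
    rw [inv_le_comm₀ (by linarith) (by norm_num)]
    linarith
  have h2 : 0 ≤ ‖u‖ ^ 3 := by positivity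
  norm_num
  nlinarith

theorem norm_logBarnesFactor_le {k : ℕ} {w : ℂ} (h : 2 * ‖w‖ ≤ (k : ℝ) + 1) :
    ‖logBarnesFactor k w‖ ≤ ‖w‖ ^ 3 * (1 / ((k : ℝ) + 1) ^ 2) := by
  have hk : (0 : ℝ) < (k : ℝ) + 1 := by positivity
  have hk' : (k : ℂ) + 1 ≠ 0 := by exact_mod_cast k.succ_ne_zero
  have hn : ‖(k : ℂ) + 1‖ = (k : ℝ) + 1 := by
    rw [← Nat.cast_add_one, Complex.norm_natCast]
    push_cast
    rfl
  have hu : ‖w / ((k : ℂ) + 1)‖ = ‖w‖ / ((k : ℝ) + 1) := by rw [norm_div, hn]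
  have h1 := norm_log_one_add_sub_le (u := w / ((k : ℂ) + 1)) (by
    rw [hu, div_le_iff₀ hk]; linarith)
  have e : logBarnesFactor k w = ((k : ℂ) + 1) * (Complex.log (1 + w / ((k : ℂ) + 1)) -
      (w / ((k : ℂ) + 1) - (w / ((k : ℂ) + 1)) ^ 2 / 2)) := by
    rw [logBarnesFactor]
    field_simp
    ring
  rw [e, norm_mul, hn]
  rw [hu] at h1
  calc _ ≤ ((k : ℝ) + 1) * (‖w‖ / ((k : ℝ) + 1)) ^ 3 := by gcongr
    _ = _ := by field_simp

theorem summable_one_div_nat_add_one_sq (K : ℕ) :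
    Summable fun k : ℕ => 1 / (((k + K : ℕ) : ℝ) + 1) ^ 2 := by
  have h := (summable_nat_add_iff (K + 1)).2 (Real.summable_one_div_nat_pow.2 one_lt_two)
  refine h.congr fun k => ?_
  push_cast
  ring_nf

theorem summable_logBarnesFactor (w : ℂ) : Summable fun k => logBarnesFactor k w := by
  obtain ⟨K, hK⟩ := exists_nat_ge (2 * ‖w‖)
  refine (summable_nat_add_iff K).1 (Summable.of_norm_bounded
    ((summable_one_div_nat_add_one_sq K).mul_left (‖w‖ ^ 3)) fun k => norm_logBarnesFactor_le ?_)
  push_cast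
  linarith [(Nat.cast_nonneg k : (0 : ℝ) ≤ k)]

theorem one_add_div_mem_slitPlane {a : ℂ} (ha : 0 < a.re) (k : ℕ) :
    1 + (a - 1) / ((k : ℂ) + 1) ∈ Complex.slitPlane := by
  left
  have e : (1 + (a - 1) / ((k : ℂ) + 1)).re = ((k : ℝ) + a.re) / ((k : ℝ) + 1) := by
    have : (k : ℂ) + 1 = (((k : ℝ) + 1 : ℝ) : ℂ) := by push_cast; rfl
    rw [this, Complex.add_re, Complex.div_ofReal_re]
    simp
    field_simp
    ring
  rw [e]
  positivity

theorem differentiableAt_logBarnesFactor {a : ℂ} (ha : 0 < a.re) (k : ℕ) :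
    DifferentiableAt ℂ (fun a => logBarnesFactor k (a - 1)) a := by
  unfold logBarnesFactor
  have h : DifferentiableAt ℂ (fun a : ℂ => 1 + (a - 1) / ((k : ℂ) + 1)) a :=
    ((differentiableAt_id.sub_const (1 : ℂ)).div_const ((k : ℂ) + 1)).const_add 1
  have h' : DifferentiableAt ℂ
      (fun a : ℂ => (a - 1) ^ 2 / (2 * ((k : ℂ) + 1)) - (a - 1)) a :=
    (((differentiableAt_id.sub_const (1 : ℂ)).pow 2).div_const _).sub
      (differentiableAt_id.sub_const 1)
  exact ((h.clog (one_add_div_mem_slitPlane ha k)).const_mul _).add h'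

theorem differentiableOn_tsum_logBarnesFactor :
    DifferentiableOn ℂ (fun a : ℂ => ∑' k, logBarnesFactor k (a - 1)) {a : ℂ | 0 < a.re} := by
  intro a ha
  replace ha : 0 < a.re := ha
  obtain ⟨K, hK⟩ := exists_nat_ge (2 * (‖a - 1‖ + 1))
  set V : Set ℂ := {b : ℂ | 0 < b.re} ∩ Metric.ball a 1 with hV
  have hVo : IsOpen V := (isOpen_lt continuous_const Complex.continuous_re).inter
    Metric.isOpen_ball
  have haV : a ∈ V := ⟨ha, Metric.mem_ball_self one_pos⟩
  have hn : ∀ b ∈ V, ‖b - 1‖ ≤ ‖a - 1‖ + 1 := by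
    intro b hb
    have h1 : ‖b - a‖ < 1 := by simpa [dist_eq_norm] using hb.2
    calc ‖b - 1‖ = ‖(b - a) + (a - 1)‖ := by ring_nf
      _ ≤ ‖b - a‖ + ‖a - 1‖ := norm_add_le _ _
      _ ≤ _ := by linarith
  have hd : DifferentiableOn ℂ (fun a : ℂ => ∑' k, logBarnesFactor (k + K) (a - 1)) V := by
    refine Complex.differentiableOn_tsum_of_summable_norm
      ((summable_one_div_nat_add_one_sq K).mul_left ((‖a - 1‖ + 1) ^ 3))
      (fun k b hb => (differentiableAt_logBarnesFactor hb.1 _).differentiableWithinAt) hVo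
      fun k b hb => ?_
    have h1 := hn b hb
    refine (norm_logBarnesFactor_le ?_).trans (by gcongr)
    push_cast
    linarith [(Nat.cast_nonneg k : (0 : ℝ) ≤ k)]
  have hf : DifferentiableAt ℂ
      (fun a : ℂ => ∑ k ∈ Finset.range K, logBarnesFactor k (a - 1)) a :=
    DifferentiableAt.fun_sum fun k _ => differentiableAt_logBarnesFactor ha k
  have e : (fun a : ℂ => ∑' k, logBarnesFactor k (a - 1)) = fun a : ℂ =>
      (∑ k ∈ Finset.range K, logBarnesFactor k (a - 1)) +
        ∑' k, logBarnesFactor (k + K) (a - 1) := by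
    funext b
    exact ((summable_logBarnesFactor (b - 1)).sum_add_tsum_nat_add K).symm
  rw [e]
  exact (hf.add (hd.differentiableAt (hVo.mem_nhds haV))).differentiableWithinAt

/-- The holomorphic branch of `log G` on the right half-plane. -/
noncomputable def logBarnesG (a : ℂ) : ℂ :=
  Complex.log (2 * (Real.pi : ℂ)) * ((a - 1) / 2) +
    -((a - 1) + (a - 1) ^ 2 * (1 + (Real.eulerMascheroniConstant : ℂ))) / 2 +
    ∑' k, logBarnesFactor k (a - 1)

theorem isLogBarnesG_logBarnesG : IsLogBarnesG logBarnesG where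
  differentiableOn := by
    unfold logBarnesG
    exact DifferentiableOn.add (by fun_prop) differentiableOn_tsum_logBarnesFactor
  exp_eq a ha := by
    have h2pi : 2 * (Real.pi : ℂ) ≠ 0 := by
      simp [Real.pi_ne_zero]
    have hp := (summable_logBarnesFactor (a - 1)).hasSum.cexp.tprod_eq
    rw [logBarnesG, Complex.exp_add, Complex.exp_add, ← hp, barnesG,
      Complex.cpow_def_of_ne_zero h2pi]
    congr 1
    refine tprod_congr fun k => ?_
    have h0 := Complex.slitPlane_ne_zero (one_add_div_mem_slitPlane ha k)
    rw [Function.comp_apply, logBarnesFactor, Complex.exp_add, ← Nat.cast_add_one,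
      Complex.exp_nat_mul, Nat.cast_add_one, Complex.exp_log h0]
  map_one := by simp [logBarnesG, logBarnesFactor]

/-- The logarithm of the `N`-th term of the sequence that defines the Glaisher-Kinkelin
constant. -/
noncomputable def logGlaisherSeq (N : ℕ) : ℝ :=
  ∑ k ∈ Finset.range N, ((k : ℝ) + 1) * Real.log ((k : ℝ) + 1) -
    ((N : ℝ) ^ 2 / 2 + (N : ℝ) / 2 + 1 / 12) * Real.log N + (N : ℝ) ^ 2 / 4

theorem exp_logGlaisherSeq {N : ℕ} (hN : 0 < N) :
    Real.exp (logGlaisherSeq N) = (∏ k ∈ Finset.Icc 1 N, (k : ℝ) ^ k) /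
      ((N : ℝ) ^ ((N : ℝ) ^ 2 / 2 + (N : ℝ) / 2 + 1 / 12) * Real.exp (-(N : ℝ) ^ 2 / 4)) := by
  have hN' : (0 : ℝ) < N := by exact_mod_cast hN
  have h1 : ∀ N : ℕ, ∏ k ∈ Finset.Icc 1 N, (k : ℝ) ^ k =
      Real.exp (∑ k ∈ Finset.range N, ((k : ℝ) + 1) * Real.log ((k : ℝ) + 1)) := by
    intro N
    induction N with
    | zero => simp
    | succ N ih =>
      have h2 : (0 : ℝ) < (N : ℝ) + 1 := by positivity
      rw [Finset.prod_Icc_succ_top (by omega), ih, Finset.sum_range_succ, Real.exp_add,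
        ← Nat.cast_add_one, Real.exp_nat_mul, Nat.cast_add_one, Real.exp_log h2]
  rw [h1, Real.rpow_def_of_pos hN', ← Real.exp_add, ← Real.exp_sub, logGlaisherSeq]
  ring_nf

theorem deriv_eulerMaclaurinSum_one_neg_one (N : ℕ) :
    deriv (eulerMaclaurinSum 1 N) (-1) = ((1 / 12 - logGlaisherSeq (N + 1) : ℝ) : ℂ) := by
  have hlog : ∀ n : ℕ, Complex.log ((n : ℂ) + 1) = (Real.log ((n : ℝ) + 1) : ℝ) := fun n => by
    rw [Complex.ofReal_log (by positivity)]
    push_cast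
    rfl
  rw [deriv_eulerMaclaurinSum_neg_one (by simp), logGlaisherSeq, Finset.sum_range_succ]
  simp only [hlog]
  push_cast
  ring

theorem tendsto_logGlaisherSeq :
    0 < glaisherKinkelin ∧
      Tendsto logGlaisherSeq atTop (𝓝 (Real.log glaisherKinkelin)) := by
  have h := (tendsto_eulerMaclaurinSum (a := 1) (by simp) neg_one_mem_emRegion).2
  simp only [deriv_eulerMaclaurinSum_one_neg_one] at h
  have h1 := ((Complex.continuous_re.tendsto _).comp h).const_sub (1 / 12)
  simp only [Function.comp_def, Complex.ofReal_re, sub_sub_cancel] at h1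
  set κ := 1 / 12 - (deriv (complexHurwitzZeta 1) (-1)).re
  have h2 : Tendsto logGlaisherSeq atTop (𝓝 κ) := (tendsto_add_atTop_iff_nat 2).1 h1
  have h3 : glaisherKinkelin = Real.exp κ := by
    refine Tendsto.limUnder_eq (((Real.continuous_exp.tendsto κ).comp h2).congr' ?_)
    filter_upwards [eventually_gt_atTop 0] with N hN
    exact exp_logGlaisherSeq hN
  rw [h3, Real.log_exp]
  exact ⟨Real.exp_pos _, h2⟩

theorem log_natCast_add {a : ℂ} {N : ℕ} (hN : 0 < N) (h : (N : ℂ) + a ≠ 0) :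
    Complex.log (N + a) = Real.log N + Complex.log (1 + a / N) := by
  have hN' : (N : ℂ) ≠ 0 := by exact_mod_cast hN.ne'
  have e : (N : ℂ) + a = ((N : ℝ) : ℂ) * (1 + a / N) := by
    push_cast
    field_simp
  have h1 : 1 + a / (N : ℂ) ≠ 0 := fun h0 => h (by rw [e, h0, mul_zero])
  rw [e, Complex.log_ofReal_mul (by exact_mod_cast hN) h1]

/-- The second-order remainder of `log(N + a) - log N`, times `N²`. -/
noncomputable def logRemainder (a : ℂ) (N : ℕ) : ℂ :=
  (N : ℂ) ^ 2 * (Complex.log (N + a) - Real.log N) - a * N + a ^ 2 / 2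

theorem tendsto_logRemainder {a : ℂ} (ha : 0 < a.re) :
    Tendsto (logRemainder a) atTop (𝓝 0) := by
  refine squeeze_zero_norm' (a := fun N : ℕ => ‖a‖ ^ 3 * (N : ℝ)⁻¹) ?_ ?_
  · obtain ⟨K, hK⟩ := exists_nat_ge (2 * ‖a‖)
    filter_upwards [eventually_gt_atTop 0, eventually_ge_atTop K] with N hN hNK
    have hN' : (0 : ℝ) < N := by exact_mod_cast hN
    have hN0 : (N : ℂ) ≠ 0 := by exact_mod_cast hN.ne'
    have hNK' : (K : ℝ) ≤ N := by exact_mod_cast hNK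
    have hu : ‖a / (N : ℂ)‖ = ‖a‖ / N := by rw [norm_div, Complex.norm_natCast]
    have h := norm_log_one_add_sub_le (u := a / N) (by
      rw [hu, div_le_iff₀ hN']; linarith)
    have e : logRemainder a N = (N : ℂ) ^ 2 * (Complex.log (1 + a / N) -
        (a / N - (a / N) ^ 2 / 2)) := by
      rw [logRemainder, log_natCast_add hN (natCast_add_ne_zero ha N)]
      field_simp
      ring
    rw [e, norm_mul, norm_pow, Complex.norm_natCast]
    rw [hu] at h
    calc _ ≤ (N : ℝ) ^ 2 * (‖a‖ / N) ^ 3 := by gcongr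
      _ = _ := by field_simp
  · simpa using (tendsto_inv_atTop_nhds_zero_nat (𝕜 := ℝ)).const_mul (‖a‖ ^ 3)

theorem sum_logBarnesFactor {a : ℂ} (ha : 0 < a.re) (N : ℕ) :
    ∑ k ∈ Finset.range N, logBarnesFactor k (a - 1) =
      ∑ k ∈ Finset.range N, ((k : ℂ) + 1) * Complex.log (k + a) -
      ((∑ k ∈ Finset.range N, ((k : ℝ) + 1) * Real.log ((k : ℝ) + 1) : ℝ) : ℂ) +
      (a - 1) ^ 2 / 2 * (((harmonic N : ℚ) : ℝ) : ℂ) - N * (a - 1) := by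
  induction N with
  | zero => simp
  | succ N ih =>
    have h0 := natCast_add_ne_zero ha N
    have h := log_natCast_add (a := a - 1) N.succ_pos (by push_cast; convert h0 using 1; ring)
    push_cast at h
    rw [show (N : ℂ) + 1 + (a - 1) = N + a by ring] at h
    have hN : (N : ℂ) + 1 ≠ 0 := by exact_mod_cast N.succ_ne_zero
    rw [Finset.sum_range_succ, ih, Finset.sum_range_succ, Finset.sum_range_succ, harmonic_succ,
      logBarnesFactor, h]
    push_cast
    field_simp
    ring

/-- The Weierstrass product of the Barnes function against Euler-Maclaurin summation. -/
theorem sum_logBarnesFactor_sub_deriv {a : ℂ} (ha : 0 < a.re) {N : ℕ} (hN : 0 < N) :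
    ∑ k ∈ Finset.range N, logBarnesFactor k (a - 1) -
      ((a - 1) * deriv (eulerMaclaurinSum a N) 0 - deriv (eulerMaclaurinSum a N) (-1)) =
    -(logGlaisherSeq N : ℂ) +
      (a - 1) ^ 2 / 2 * (((harmonic N : ℝ) - Real.log N : ℝ) : ℂ) +
      (a ^ 2 / 2 - a / 2 + 1 / 12 + logRemainder a N / 2 +
        (logRemainder a N - a ^ 2 / 2) * (N : ℂ)⁻¹ / 2 +
        (-a ^ 2 / 2 + a - 5 / 12) * (a * (N : ℂ)⁻¹ +
          (logRemainder a N - a ^ 2 / 2) * (N : ℂ)⁻¹ * (N : ℂ)⁻¹) -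
        (a - 1) * ((N : ℂ) + a)⁻¹ / 12) := by
  have hN0 : (N : ℂ) ≠ 0 := by exact_mod_cast hN.ne'
  have hs : ∑ k ∈ Finset.range N, ((k : ℂ) + 1) * Complex.log (k + a) =
      ∑ k ∈ Finset.range N, ((k : ℂ) + a) * Complex.log (k + a) -
        (a - 1) * ∑ k ∈ Finset.range N, Complex.log (k + a) := by
    rw [Finset.mul_sum, ← Finset.sum_sub_distrib]
    exact Finset.sum_congr rfl fun k _ => by ring
  have hx : Complex.log (N + a) =
      Real.log N + (a * N - a ^ 2 / 2 + logRemainder a N) * (N : ℂ)⁻¹ * (N : ℂ)⁻¹ := by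
    rw [logRemainder]
    field_simp
    ring
  rw [sum_logBarnesFactor ha, deriv_eulerMaclaurinSum_zero ha, deriv_eulerMaclaurinSum_neg_one ha,
    hs, logGlaisherSeq, hx]
  generalize logRemainder a N = ρ
  generalize ((N : ℂ) + a)⁻¹ = y
  push_cast
  field_simp
  ring

theorem tsum_logBarnesFactor {a : ℂ} (ha : 0 < a.re) :
    ∑' k, logBarnesFactor k (a - 1) =
      (a - 1) * deriv (complexHurwitzZeta a) 0 - deriv (complexHurwitzZeta a) (-1) -
      (Real.log glaisherKinkelin : ℂ) + (a - 1) ^ 2 / 2 * (Real.eulerMascheroniConstant : ℂ) +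
      (a ^ 2 / 2 - a / 2 + 1 / 12) := by
  have h1 := (summable_logBarnesFactor (a - 1)).hasSum.tendsto_sum_nat
  have h2 := (tendsto_add_atTop_iff_nat
    (f := fun N => deriv (eulerMaclaurinSum a N) 0) 1).1 (tendsto_eulerMaclaurinSum ha zero_mem_emRegion).2
  have h3 := (tendsto_add_atTop_iff_nat
    (f := fun N => deriv (eulerMaclaurinSum a N) (-1)) 1).1 (tendsto_eulerMaclaurinSum ha neg_one_mem_emRegion).2
  have h4 := (Complex.continuous_ofReal.tendsto _).comp tendsto_logGlaisherSeq.2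
  have h5 := (Complex.continuous_ofReal.tendsto _).comp Real.tendsto_harmonic_sub_log
  have h6 := tendsto_logRemainder ha
  have h7 : Tendsto (fun N : ℕ => (N : ℂ)⁻¹) atTop (𝓝 0) := tendsto_inv_atTop_nhds_zero_nat
  have h8 : Tendsto (fun N : ℕ => ((N : ℂ) + a)⁻¹) atTop (𝓝 0) := by
    simpa [Complex.cpow_neg_one] using tendsto_natCast_add_cpow (c := -1) ha (by simp)
  have hl := h1.sub ((h2.const_mul (a - 1)).sub h3)
  have hr := (h4.neg.add (h5.const_mul ((a - 1) ^ 2 / 2))).add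
    (((((h6.div_const 2).const_add (a ^ 2 / 2 - a / 2 + 1 / 12)).add
      (((h6.sub_const (a ^ 2 / 2)).mul h7).div_const 2)).add
      (((h7.const_mul a).add (((h6.sub_const (a ^ 2 / 2)).mul h7).mul h7)).const_mul
        (-a ^ 2 / 2 + a - 5 / 12))).sub ((h8.const_mul (a - 1)).div_const 12))
  have h := tendsto_nhds_unique (hl.congr' ?_) hr
  · linear_combination h
  · filter_upwards [eventually_gt_atTop 0] with N hN
    exact sum_logBarnesFactor_sub_deriv ha hN

theorem logBarnesG_eq_hurwitzG {a : ℂ} (ha : 0 < a.re) :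
    logBarnesG a = barnesPoly a + (a - 1) * hurwitzG 0 a - hurwitzG 1 a := by
  have d1 : Complex.digamma (((0 : ℕ) : ℂ) + 1) = -(Real.eulerMascheroniConstant : ℂ) := by
    rw [Nat.cast_zero, zero_add, Complex.digamma_one]
  have d2 : Complex.digamma (((1 : ℕ) : ℂ) + 1) = 1 - (Real.eulerMascheroniConstant : ℂ) := by
    rw [Nat.cast_one, Complex.digamma_apply_add_one _ fun m hm => ?_, Complex.digamma_one]
    · ring
    · have := congrArg Complex.re hm
      simp at this
      linarith [(Nat.cast_nonneg m : (0 : ℝ) ≤ m)]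
  have h2pi : Complex.log (2 * (Real.pi : ℂ)) = (Real.log (2 * Real.pi) : ℝ) := by
    rw [Complex.ofReal_log (by positivity)]
    push_cast
    rfl
  have hs : Real.log √(2 * Real.pi) = Real.log (2 * Real.pi) / 2 :=
    Real.log_sqrt (by positivity)
  rw [logBarnesG, tsum_logBarnesFactor ha, hurwitzG, hurwitzG, d1, d2, barnesPoly, h2pi,
    Real.log_mul tendsto_logGlaisherSeq.1.ne' (by positivity), hs]
  simp only [Nat.cast_zero, Nat.cast_one, neg_zero, complexHurwitzZeta_zero ha,
    complexHurwitzZeta_neg_one ha]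
  push_cast
  ring

/-- Two integrands that agree when `e^ℓ = z` have the same Hankel integral. -/
theorem hankelIntegral_congr {F H : ℂ → ℂ → ℂ} {ε : ℝ} (hε : 0 < ε)
    (h : ∀ z ℓ, Complex.exp ℓ = z → F z ℓ = H z ℓ) (hH : HankelIntegrable H ε) :
    HankelIntegrable F ε ∧ hankelIntegral F ε = hankelIntegral H ε := by
  have hx : ∀ x : ℝ, 0 < x → ∀ c : ℂ, Complex.exp c = -1 →
      Complex.exp ((Real.log x : ℂ) + c) = -(x : ℂ) := fun x hx c hc => by
    rw [Complex.exp_add, hc, ← Complex.ofReal_exp, Real.exp_log hx]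
    ring
  have hpi' : Complex.exp (-(Real.pi * Complex.I)) = -1 := by
    rw [Complex.exp_neg, Complex.exp_pi_mul_I]; norm_num
  have e1 : Set.EqOn (fun x : ℝ => F (-(x : ℂ)) ((Real.log x : ℂ) - Real.pi * Complex.I))
      (fun x : ℝ => H (-(x : ℂ)) ((Real.log x : ℂ) - Real.pi * Complex.I)) (Set.Ioi ε) :=
    fun x hx' => h _ _ (by rw [sub_eq_add_neg]; exact hx x (hε.trans hx') _ hpi')
  have e2 : Set.EqOn (fun x : ℝ => F (-(x : ℂ)) ((Real.log x : ℂ) + Real.pi * Complex.I))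
      (fun x : ℝ => H (-(x : ℂ)) ((Real.log x : ℂ) + Real.pi * Complex.I)) (Set.Ioi ε) :=
    fun x hx' => h _ _ (hx x (hε.trans hx') _ Complex.exp_pi_mul_I)
  have e3 : ∀ θ : ℝ, F (ε * Complex.exp (θ * Complex.I)) ((Real.log ε : ℂ) + θ * Complex.I) =
      H (ε * Complex.exp (θ * Complex.I)) ((Real.log ε : ℂ) + θ * Complex.I) :=
    fun θ => h _ _ (by rw [Complex.exp_add, ← Complex.ofReal_exp, Real.exp_log hε])
  refine ⟨⟨hH.1.congr_fun e1.symm measurableSet_Ioi, ?_,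
    hH.2.2.congr_fun e2.symm measurableSet_Ioi⟩, ?_⟩
  · simp only [e3]
    exact hH.2.1
  · simp only [hankelIntegral, e3]
    rw [setIntegral_congr_fun measurableSet_Ioi e1, setIntegral_congr_fun measurableSet_Ioi e2]

theorem hankelIntegral_const_mul_sub {F H : ℂ → ℂ → ℂ} {ε : ℝ} (c : ℂ)
    (hF : HankelIntegrable F ε) (hH : HankelIntegrable H ε) :
    HankelIntegrable (fun z ℓ => c * F z ℓ - H z ℓ) ε ∧
      hankelIntegral (fun z ℓ => c * F z ℓ - H z ℓ) ε =
        c * hankelIntegral F ε - hankelIntegral H ε := by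
  refine ⟨⟨(hF.1.const_mul c).sub hH.1, ?_, (hF.2.2.const_mul c).sub hH.2.2⟩, ?_⟩
  · simp only [sub_mul, mul_assoc c]
    exact (hF.2.1.const_mul c).sub hH.2.1
  · simp only [hankelIntegral, sub_mul, mul_assoc c]
    rw [integral_sub (hF.1.const_mul c) hH.1, integral_sub (hF.2.2.const_mul c) hH.2.2,
      intervalIntegral.integral_sub (hF.2.1.const_mul c) hH.2.1, integral_const_mul,
      integral_const_mul, intervalIntegral.integral_const_mul]
    ring

theorem barnesIntegrand_eq {a z ℓ : ℂ} (h : Complex.exp ℓ = z) :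
    barnesIntegrand a z ℓ = (a - 1) * (ℓ * hankelKernel a (-((0 : ℕ) : ℂ)) z ℓ) -
      ℓ * hankelKernel a (-((1 : ℕ) : ℂ)) z ℓ := by
  have h1 : Complex.exp ((-((0 : ℕ) : ℂ) - 1) * ℓ) = z⁻¹ := by
    rw [← h, ← Complex.exp_neg]
    congr 1
    push_cast
    ring
  have h2 : Complex.exp ((-((1 : ℕ) : ℂ) - 1) * ℓ) = (z ^ 2)⁻¹ := by
    rw [← h, ← Complex.exp_nat_mul, ← Complex.exp_neg]
    congr 1
    push_cast
    ring
  rw [barnesIntegrand, hankelKernel, hankelKernel, h1, h2]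
  ring

theorem hankelIntegral_barnesIntegrand {a : ℂ} (ha : 0 < a.re) {ε : ℝ} (hε : 0 < ε)
    (hε' : ε < 2 * Real.pi) :
    HankelIntegrable (barnesIntegrand a) ε ∧
      1 / (2 * Real.pi * Complex.I) * hankelIntegral (barnesIntegrand a) ε =
        (a - 1) * hurwitzG 0 a - hurwitzG 1 a := by
  obtain ⟨i, e⟩ := hankelIntegral_const_mul_sub (a - 1)
    (hankelKernel_integrable_hasDerivAt ha hε hε' (-((0 : ℕ) : ℂ))).2.1
    (hankelKernel_integrable_hasDerivAt ha hε hε' (-((1 : ℕ) : ℂ))).2.1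
  obtain ⟨i', e'⟩ := hankelIntegral_congr hε (fun z ℓ h => barnesIntegrand_eq (a := a) h) i
  refine ⟨i', ?_⟩
  rw [e', e, hurwitzG_eq_hankel ha hε hε', hurwitzG_eq_hankel ha hε hε', Nat.factorial_zero,
    Nat.factorial_one]
  push_cast
  ring

theorem mainTheorem7 :
    ∃ L : ℂ → ℂ, IsLogBarnesG L ∧
      ∀ a : ℂ, 0 < a.re →
        (∀ ε : ℝ, 0 < ε → ε < 2 * Real.pi →
          HankelIntegrable (barnesIntegrand a) ε ∧
          L a = barnesPoly a +
            1 / (2 * Real.pi * Complex.I) * hankelIntegral (barnesIntegrand a) ε) ∧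
        L a = barnesPoly a + (a - 1) * hurwitzG 0 a - hurwitzG 1 a := by
  refine ⟨logBarnesG, isLogBarnesG_logBarnesG, fun a ha => ⟨fun ε hε hε' => ?_,
    logBarnesG_eq_hurwitzG ha⟩⟩
  obtain ⟨h1, h2⟩ := hankelIntegral_barnesIntegrand ha hε hε'
  refine ⟨h1, ?_⟩
  rw [h2, logBarnesG_eq_hurwitzG ha]
  ring
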